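/- Let $K$ be a field, $m\ge 4$, and let $\mathcal Q$ be the quiver with vertices $i\in\mathbb Z/m$ and arrows $a_i\colon i\to i+1$, $\bar a_i\colon i+1\to i$ (paths are written from left to right, $e_i$ is the trivial path at $i$). Let $\Lambda=K\mathcal Q/I$, where $I$ is generated by $a_ia_{i+1}$, $\bar a_{i-1}\bar a_{i-2}$, $a_i\bar a_i-\bar a_{i-1}a_{i-1}$ $(i\in\mathbb Z/m)$, and for $q=(q_i)\in(K^*)^m$ let $\Lambda_q$ be the algebra obtained by replacing the last relations by $q_ia_i\bar a_i-\bar a_{i-1}a_{i-1}$. A finite-dimensional $K$-algebra $A$ is a socle deformation of $\Lambda$ if $A$ is self-injective and $A/\operatorname{soc}A\cong\Lambda/\operatorname{soc}\Lambda$ as $K$-algebras. Let $f$ be a Hochschild $2$-cocycle of $\Lambda$ and $\eta\in HH^2(\Lambda)$ its class. Its value at the relation $a_i\bar a_i-\bar a_{i-1}a_{i-1}$ is $\eta(e_i\otimes_{1,i}e_i)=e_i\bigl(f(a_i,\bar a_i)-f(\bar a_{i-1},a_{i-1})\bigr)e_i\in e_i\Lambda e_i$, and it can be written uniquely as $c_ie_i+d_ia_i\bar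 a_i$ with $c_i,d_i\in K$. For $t\in K$ let $J_\eta=J_{\eta,t}$ be the ideal of $K\mathcal Q$ generated by $a_ia_{i+1}$, $\bar a_{i-1}\bar a_{i-2}$ and $a_i\bar a_i-\bar a_{i-1}a_{i-1}-t(c_ie_i+d_ia_i\bar a_i)$ for $i\in\mathbb Z/m$; it depends on the chosen representative $f$ of $\eta$. Let $\pi\in HH^2(\Lambda)$ be the class whose values are $a_0\bar a_0$ at $i=0$ and $0$ at $i\ne0$: it is represented by the cocycle that sends $(a_0,\bar a_0)$ to $a_0\bar a_0$ and every other pair of elements of the basis $\{e_i,a_i,\bar a_i,a_i\bar a_i\}$ to $0$. Theorem. Fix $t\in K$, $t\neq 0$. (1) Let $\eta\in HH^2(\Lambda)$, and let $J_\eta$ be formed from any representing cocycle, with coefficients $c_i,d_i$. If $td_i\ne1$ for all $i$, then $K\mathcal Q/J_\eta$ is a socle deformation of $\Lambda$ if and only if $\eta$ is a scalar multiple of $\pi$. If $td_i=1$ for some $i$, then $K\mathcal Q/J_\eta$ is not a socle deformation of $\Lambda$. (2) The socle deformations of $\Lambda$ arising from formal deformations are exactly the algebras $\Lambda_q$: a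 $K$-algebra $A$ is isomorphic to $\Lambda_q$ for some $q\in(K^*)^m$ if and only if $A$ is a socle deformation of $\Lambda$ and there are $\eta\in HH^2(\Lambda)$ and a formal deformation of $\Lambda$ with infinitesimal $\eta$, polynomial in the deformation parameter $T$, whose specialization at $T=t$ is isomorphic to $K\mathcal Q/J_\eta$ (for some representative of $\eta$), such that $A\cong K\mathcal Q/J_\eta$. -/

import Mathlib

set_option maxSynthPendingDepth 3

noncomputable section

namespace SocleDeformation

universe u v w

/-! ### Hochschild cohomology in degree two -/

section Hochschild

variable (K : Type u) (A : Type v) [Field K] [Ring A] [Algebra K A]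

/-- Hochschild `2`-cocycles of the `K`-algebra `A` with coefficients in `A` (bar complex):
bilinear maps `f` with `x f(y,z) - f(xy,z) + f(x,yz) - f(x,y) z = 0`. -/
def Cocycle2 : Submodule K (A →ₗ[K] A →ₗ[K] A) where
  carrier := {f | ∀ x y z : A, x * f y z - f (x * y) z + f x (y * z) - f x y * z = 0}
  zero_mem' := by intro x y z; simp
  add_mem' := by
    intro f g hf hg x y z
    have h := congrArg₂ (· + ·) (hf x y z) (hg x y z)
    simp only [add_zero] at h
    rw [← h]
    simp only [LinearMap.add_apply, mul_add, add_mul]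
    abel
  smul_mem' := by
    intro c f hf x y z
    have h := congrArg (c • ·) (hf x y z)
    simp only [smul_zero] at h
    rw [← h]
    simp only [LinearMap.smul_apply, mul_smul_comm, smul_mul_assoc, smul_sub, smul_add]

/-- Hochschild `2`-coboundaries: the bilinear maps `(x, y) ↦ x φ(y) - φ(xy) + φ(x) y`. -/
def Coboundary2 : Submodule K (A →ₗ[K] A →ₗ[K] A) where
  carrier := {f | ∃ φ : A →ₗ[K] A, ∀ x y : A, f x y = x * φ y - φ (x * y) + φ x * y}
  zero_mem' := ⟨0, by intro x y; simp⟩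
  add_mem' := by
    rintro f g ⟨φ, hφ⟩ ⟨ψ, hψ⟩
    refine ⟨φ + ψ, fun x y => ?_⟩
    simp only [LinearMap.add_apply, hφ, hψ, mul_add, add_mul]
    abel
  smul_mem' := by
    rintro c f ⟨φ, hφ⟩
    refine ⟨c • φ, fun x y => ?_⟩
    simp only [LinearMap.smul_apply, hφ, mul_smul_comm, smul_mul_assoc, smul_sub, smul_add]

/-- `HH²(A)`: cocycles modulo coboundaries (every coboundary is a cocycle). Since `K` is a field
this is `Ext²` of `A` by `A` over the enveloping algebra. -/
abbrev HH2 : Type v :=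
  Cocycle2 K A ⧸ (Coboundary2 K A).submoduleOf (Cocycle2 K A)

variable {K A}

/-- The class of a cocycle in `HH²(A)`. -/
def toHH2 (f : Cocycle2 K A) : HH2 K A :=
  ((Coboundary2 K A).submoduleOf (Cocycle2 K A)).mkQ f

theorem coboundary2_le_cocycle2 : Coboundary2 K A ≤ Cocycle2 K A := by
  rintro f ⟨φ, hφ⟩ x y z
  simp only [hφ, mul_add, add_mul, mul_sub, sub_mul, mul_assoc]
  abel

variable (K A)

/-- A formal deformation of `A` in the sense of Gerstenhaber: a `K[[T]]`-bilinear associative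
product `x * y = ∑ₙ μₙ(x, y) Tⁿ` on `A[[T]]`, with `μ₀` the product of `A`. -/
structure FormalDeformation where
  μ : ℕ → A →ₗ[K] A →ₗ[K] A
  zero : ∀ x y, μ 0 x y = x * y
  assoc : ∀ (n : ℕ) (x y z : A),
    ∑ p ∈ Finset.HasAntidiagonal.antidiagonal n, μ p.1 (μ p.2 x y) z =
      ∑ p ∈ Finset.HasAntidiagonal.antidiagonal n, μ p.1 x (μ p.2 y z)

variable {K A}

theorem FormalDeformation.one_mem (D : FormalDeformation K A) : D.μ 1 ∈ Cocycle2 K A := by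
  intro x y z
  have h := D.assoc 1 x y z
  simp only [Finset.Nat.antidiagonal_succ, Finset.Nat.antidiagonal_zero, Finset.sum_cons,
    Finset.map_singleton, Finset.sum_singleton, Function.Embedding.prodMap, D.zero,
    Function.Embedding.coeFn_mk, Prod.map, Function.Embedding.refl_apply, Nat.succ_eq_add_one,
    zero_add] at h
  calc _ = (x * D.μ 1 y z + D.μ 1 x (y * z)) - (D.μ 1 x y * z + D.μ 1 (x * y) z) := by abel
    _ = 0 := by rw [h, sub_self]

/-- The infinitesimal of a formal deformation. -/
def FormalDeformation.infinitesimal (D : FormalDeformation K A) : HH2 K A :=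
  toHH2 ⟨D.μ 1, D.one_mem⟩

/-- `B` is the algebra obtained from the formal deformation `D` (which has to be polynomial in
the parameter `T`) by specializing `T` to `t`: up to isomorphism, `B` is the vector space `A`
with the product `∑ₙ tⁿ μₙ(x, y)`. -/
def FormalDeformation.SpecializesTo (D : FormalDeformation K A) (t : K)
    (B : Type w) [Ring B] [Algebra K B] : Prop :=
  ∃ N : ℕ, (∀ n, N ≤ n → D.μ n = 0) ∧
    ∃ φ : A ≃ₗ[K] B, ∀ x y : A, φ (∑ n ∈ Finset.range N, t ^ n • D.μ n x y) = φ x * φ y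

end Hochschild

/-! ### Socles and socle deformations -/

/-- The (left) socle of a ring: the sum of its minimal left ideals. -/
def soc (A : Type v) [Ring A] : Ideal A :=
  sSup {I : Ideal A | IsSimpleModule A I}

instance soc_isTwoSided (A : Type v) [Ring A] : (soc A).IsTwoSided := by
  refine ⟨fun {x} b hx => ?_⟩
  have h : soc A ≤ Submodule.comap (LinearMap.toSpanSingleton A A b) (soc A) := by
    refine sSup_le fun I hI => ?_
    have : IsSimpleModule A I := hI
    intro y hy
    rw [Submodule.mem_comap]
    obtain inj | hz := ((LinearMap.toSpanSingleton A A b).domRestrict I).injective_or_eq_zero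
    · have e := LinearEquiv.ofInjective _ inj
      have hs : IsSimpleModule A
          (LinearMap.range ((LinearMap.toSpanSingleton A A b).domRestrict I)) :=
        IsSimpleModule.congr e.symm
      exact (le_sSup hs : _ ≤ soc A) ⟨⟨y, hy⟩, rfl⟩
    · have := LinearMap.congr_fun hz ⟨y, hy⟩
      simp only [LinearMap.domRestrict_apply, LinearMap.zero_apply] at this
      rw [this]
      exact zero_mem _
  simpa using h hx

/-- A self-injective algebra: finite-dimensional, and injective as a module over itself. -/
def IsSelfInjective (K : Type u) (A : Type v) [Field K] [Ring A] [Algebra K A] : Prop :=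
  Module.Finite K A ∧ Module.Injective A A

/-- `A` is a socle deformation of `B`: it is self-injective and `A / soc A ≅ B / soc B`. -/
def IsSocleDeformation (K : Type u) (A : Type v) (B : Type w) [Field K]
    [Ring A] [Algebra K A] [Ring B] [Algebra K B] : Prop :=
  IsSelfInjective K A ∧ Nonempty ((A ⧸ soc A) ≃ₐ[K] (B ⧸ soc B))

/-! ### The quiver, its path algebra and the quotients -/

/-- Trivial paths `e i` at the vertices `i ∈ ℤ/m`, arrows `a i : i ⟶ i + 1` and
`abar i : i + 1 ⟶ i`. -/
inductive Gen (m : ℕ) : Type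
  | e : ZMod m → Gen m
  | a : ZMod m → Gen m
  | abar : ZMod m → Gen m

section Quiver

variable (K : Type u) [Field K] (m : ℕ) [NeZero m]

open FreeAlgebra in
/-- The relations of the path algebra (paths are written from left to right): the `e i` are
orthogonal idempotents with sum `1`, and `o(α) α = α = α t(α)` for every arrow `α`. -/
inductive PathRel : FreeAlgebra K (Gen m) → FreeAlgebra K (Gen m) → Prop
  | one : PathRel (∑ i : ZMod m, ι K (Gen.e i)) 1
  | idem (i : ZMod m) : PathRel (ι K (Gen.e i) * ι K (Gen.e i)) (ι K (Gen.e i))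
  | orth (i j : ZMod m) (h : i ≠ j) : PathRel (ι K (Gen.e i) * ι K (Gen.e j)) 0
  | a_origin (i : ZMod m) : PathRel (ι K (Gen.e i) * ι K (Gen.a i)) (ι K (Gen.a i))
  | a_terminus (i : ZMod m) : PathRel (ι K (Gen.a i) * ι K (Gen.e (i + 1))) (ι K (Gen.a i))
  | abar_origin (i : ZMod m) :
      PathRel (ι K (Gen.e (i + 1)) * ι K (Gen.abar i)) (ι K (Gen.abar i))
  | abar_terminus (i : ZMod m) :
      PathRel (ι K (Gen.abar i) * ι K (Gen.e i)) (ι K (Gen.abar i))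

/-- The path algebra `K𝒬`. -/
abbrev PathAlg : Type u := RingQuot (PathRel K m)

variable {K m}

/-- The image of a vertex or an arrow in the path algebra. -/
def gen (g : Gen m) : PathAlg K m := RingQuot.mkAlgHom K (PathRel K m) (FreeAlgebra.ι K g)

/-- The generators `aᵢ aᵢ₊₁`, `āᵢ₋₁ āᵢ₋₂` and `r i` (for `i ∈ ℤ/m`) of a two-sided ideal of the
path algebra. -/
inductive IdealRel (r : ZMod m → PathAlg K m) : PathAlg K m → PathAlg K m → Prop
  | aa (i : ZMod m) : IdealRel r (gen (Gen.a i) * gen (Gen.a (i + 1))) 0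
  | abar_abar (i : ZMod m) : IdealRel r (gen (Gen.abar (i - 1)) * gen (Gen.abar (i - 2))) 0
  | third (i : ZMod m) : IdealRel r (r i) 0

/-- The quotient of the path algebra by the ideal generated by all `aᵢ aᵢ₊₁`, `āᵢ₋₁ āᵢ₋₂` and
`r i`. -/
abbrev QuotAlg (r : ZMod m → PathAlg K m) : Type u := RingQuot (IdealRel r)

variable (K m)

/-- The relations `aᵢ āᵢ - āᵢ₋₁ aᵢ₋₁` of `Λ`. -/
def lamRel (i : ZMod m) : PathAlg K m :=
  gen (Gen.a i) * gen (Gen.abar i) - gen (Gen.abar (i - 1)) * gen (Gen.a (i - 1))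

/-- The algebra `Λ`, with relations `aᵢ aᵢ₊₁`, `āᵢ₋₁ āᵢ₋₂`, `aᵢ āᵢ - āᵢ₋₁ aᵢ₋₁`. -/
abbrev Lam : Type u := QuotAlg (lamRel K m)

variable {K m}

/-- The relations `qᵢ aᵢ āᵢ - āᵢ₋₁ aᵢ₋₁` of `Λ_q`. -/
def lamQRel (q : ZMod m → Kˣ) (i : ZMod m) : PathAlg K m :=
  (q i : K) • (gen (Gen.a i) * gen (Gen.abar i)) -
    gen (Gen.abar (i - 1)) * gen (Gen.a (i - 1))

/-- The algebra `Λ_q`, with relations `aᵢ aᵢ₊₁`, `āᵢ₋₁ āᵢ₋₂`, `qᵢ aᵢ āᵢ - āᵢ₋₁ aᵢ₋₁`,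
for `q ∈ (K*)ᵐ`. -/
abbrev LamQ (q : ZMod m → Kˣ) : Type u := QuotAlg (lamQRel q)

/-- The elements `aᵢ āᵢ - āᵢ₋₁ aᵢ₋₁ - t (cᵢ eᵢ + dᵢ aᵢ āᵢ)`. -/
def lamJRel (t : K) (c d : ZMod m → K) (i : ZMod m) : PathAlg K m :=
  gen (Gen.a i) * gen (Gen.abar i) - gen (Gen.abar (i - 1)) * gen (Gen.a (i - 1)) -
    t • (c i • gen (Gen.e i) + d i • (gen (Gen.a i) * gen (Gen.abar i)))

/-- The algebra `K𝒬 / J` for the ideal `J` generated by `aᵢ aᵢ₊₁`, `āᵢ₋₁ āᵢ₋₂` and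
`aᵢ āᵢ - āᵢ₋₁ aᵢ₋₁ - t (cᵢ eᵢ + dᵢ aᵢ āᵢ)`. It is `K𝒬 / J_η` when
`η(eᵢ ⊗_{1,i} eᵢ) = cᵢ eᵢ + dᵢ aᵢ āᵢ`. -/
abbrev LamJ (t : K) (c d : ZMod m → K) : Type u := QuotAlg (lamJRel t c d)

variable (K m)

/-- The projection of the path algebra onto `Λ`. -/
def lamHom : PathAlg K m →ₐ[K] Lam K m := RingQuot.mkAlgHom K (IdealRel (lamRel K m))

variable {K m}

/-- The image of a vertex or an arrow in `Λ`. -/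
def lam (g : Gen m) : Lam K m := lamHom K m (gen g)

/-- The value `η(eᵢ ⊗_{1,i} eᵢ) ∈ eᵢ Λ eᵢ` at the relation `aᵢ āᵢ - āᵢ₋₁ aᵢ₋₁` of the
`2`-cocycle `f`. It is the value at `eᵢ ⊗_{1,i} eᵢ` of the pullback of `f` along the morphism
from the minimal projective bimodule resolution to the bar resolution that sends, in degree two,
the generator of `P²` attached to a relation `∑ c αβ` (paths of length two from `v` to `w`) to
`∑ c e_v ⊗ α ⊗ β ⊗ e_w`. -/
def valueAt (f : Cocycle2 K (Lam K m)) (i : ZMod m) : Lam K m :=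
  lam (Gen.e i) *
    (f.1 (lam (Gen.a i)) (lam (Gen.abar i)) -
      f.1 (lam (Gen.abar (i - 1))) (lam (Gen.a (i - 1)))) *
    lam (Gen.e i)

/-- The values of `f` at the relations are `cᵢ eᵢ + dᵢ aᵢ āᵢ`. -/
def HasValues (f : Cocycle2 K (Lam K m)) (c d : ZMod m → K) : Prop :=
  ∀ i, valueAt f i = c i • lam (Gen.e i) + d i • (lam (Gen.a i) * lam (Gen.abar i))

/-- `A` arises from a formal deformation of `Λ` at the parameter value `t`: for some class
`η ∈ HH²(Λ)` there is a formal deformation of `Λ` with infinitesimal `η` which specializes at `t`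
to `K𝒬 / J_η`, and `A` is isomorphic to `K𝒬 / J_η`. -/
def ArisesFromFormalDeformation (K : Type u) [Field K] (m : ℕ) [NeZero m] (t : K)
    (A : Type w) [Ring A] [Algebra K A] : Prop :=
  ∃ (D : FormalDeformation K (Lam K m)) (f : Cocycle2 K (Lam K m)) (c d : ZMod m → K),
    toHH2 f = D.infinitesimal ∧ HasValues f c d ∧
      D.SpecializesTo t (LamJ t c d) ∧ Nonempty (A ≃ₐ[K] LamJ t c d)

/-! ### The class `π` -/

/-- The images of the generators in the representation of dimension two given by the arrow `a₀`
(if `b = true`) or `ā₀` (if `b = false`): that arrow acts as the matrix unit `E₀₁`, all other arrows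
act as zero. -/
def arrowMat (b : Bool) : Gen m → Matrix (Fin 2) (Fin 2) K
  | Gen.e i => !![if i = (if b then 0 else 1) then 1 else 0, 0;
      0, if i = (if b then 1 else 0) then 1 else 0]
  | Gen.a i => !![0, if b = true ∧ i = 0 then 1 else 0; 0, 0]
  | Gen.abar i => !![0, if b = false ∧ i = 0 then 1 else 0; 0, 0]

theorem arrowMat_pathRel (b : Bool) ⦃x y : FreeAlgebra K (Gen m)⦄ (h : PathRel K m x y) :
    FreeAlgebra.lift K (arrowMat (K := K) b) x = FreeAlgebra.lift K (arrowMat b) y := by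
  cases h with
  | one =>
    rw [map_sum, map_one]
    ext k l
    rw [Matrix.sum_apply]
    fin_cases k <;> fin_cases l <;> simp [arrowMat]
  | idem i =>
    simp only [map_mul, FreeAlgebra.lift_ι_apply]
    ext k l
    fin_cases k <;> fin_cases l <;> simp [arrowMat, Matrix.mul_apply]
  | orth i j h =>
    simp only [map_mul, FreeAlgebra.lift_ι_apply, map_zero]
    ext k l
    fin_cases k <;> fin_cases l <;> simp [arrowMat, Matrix.mul_apply] <;> grind
  | a_origin i =>
    simp only [map_mul, FreeAlgebra.lift_ι_apply]
    ext k l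
    fin_cases k <;> fin_cases l <;> cases b <;> simp [arrowMat, Matrix.mul_apply]
  | a_terminus i =>
    simp only [map_mul, FreeAlgebra.lift_ι_apply]
    ext k l
    fin_cases k <;> fin_cases l <;> cases b <;> simp [arrowMat, Matrix.mul_apply]
  | abar_origin i =>
    simp only [map_mul, FreeAlgebra.lift_ι_apply]
    ext k l
    fin_cases k <;> fin_cases l <;> cases b <;> simp [arrowMat, Matrix.mul_apply]
  | abar_terminus i =>
    simp only [map_mul, FreeAlgebra.lift_ι_apply]
    ext k l
    fin_cases k <;> fin_cases l <;> cases b <;> simp [arrowMat, Matrix.mul_apply]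

/-- The representation on the path algebra. -/
def arrowRepPath (b : Bool) : PathAlg K m →ₐ[K] Matrix (Fin 2) (Fin 2) K :=
  RingQuot.liftAlgHom K ⟨FreeAlgebra.lift K (arrowMat b), arrowMat_pathRel b⟩

theorem arrowRepPath_gen (b : Bool) (g : Gen m) :
    arrowRepPath (K := K) b (gen g) = arrowMat b g := by
  simp [arrowRepPath, gen]

theorem arrowRepPath_rel (b : Bool) ⦃x y : PathAlg K m⦄ (h : IdealRel (lamRel K m) x y) :
    arrowRepPath (K := K) b x = arrowRepPath b y := by
  cases h with
  | aa i =>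
    simp only [map_mul, map_zero, arrowRepPath_gen]
    ext k l
    fin_cases k <;> fin_cases l <;> simp [arrowMat, Matrix.mul_apply]
  | abar_abar i =>
    simp only [map_mul, map_zero, arrowRepPath_gen]
    ext k l
    fin_cases k <;> fin_cases l <;> simp [arrowMat, Matrix.mul_apply]
  | third i =>
    simp only [lamRel, map_mul, map_sub, map_zero, arrowRepPath_gen]
    ext k l
    fin_cases k <;> fin_cases l <;> simp [arrowMat] <;> split_ifs <;> simp

/-- The representation of `Λ` of dimension two given by the arrow `a₀` or `ā₀`. -/
def arrowRep (b : Bool) : Lam K m →ₐ[K] Matrix (Fin 2) (Fin 2) K :=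
  RingQuot.liftAlgHom K ⟨arrowRepPath b, arrowRepPath_rel b⟩

theorem arrowRep_lam (b : Bool) (g : Gen m) :
    arrowRep (K := K) b (lam g) = arrowMat b g := by
  simp [arrowRep, lam, lamHom, arrowRepPath_gen]

/-- The coefficient of `a₀` (if `b = true`) or `ā₀` (if `b = false`) in an element of `Λ`. -/
def arrowCoeff (b : Bool) (x : Lam K m) : K := arrowRep b x 0 1

theorem lam_induction {P : Lam K m → Prop} (hgen : ∀ g, P (lam g))
    (hscalar : ∀ c : K, P (algebraMap K (Lam K m) c))
    (hadd : ∀ x y, P x → P y → P (x + y)) (hmul : ∀ x y, P x → P y → P (x * y)) (x : Lam K m) :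
    P x := by
  obtain ⟨x, rfl⟩ := RingQuot.mkAlgHom_surjective K _ x
  obtain ⟨x, rfl⟩ := RingQuot.mkAlgHom_surjective K _ x
  induction x using FreeAlgebra.induction with
  | grade0 c => simpa only [AlgHom.commutes] using hscalar c
  | grade1 g => exact hgen g
  | mul x y hx hy => simpa only [map_mul] using hmul _ _ hx hy
  | add x y hx hy => simpa only [map_add] using hadd _ _ hx hy

theorem gen_rel {x y : FreeAlgebra K (Gen m)} (h : PathRel K m x y) :
    RingQuot.mkAlgHom K (PathRel K m) x = RingQuot.mkAlgHom K (PathRel K m) y :=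
  RingQuot.mkAlgHom_rel K h

theorem lamHom_rel {x y : PathAlg K m} (h : IdealRel (lamRel K m) x y) :
    lamHom K m x = lamHom K m y :=
  RingQuot.mkAlgHom_rel K h

theorem lam_e_mul_e (i j : ZMod m) :
    (lam (Gen.e i) * lam (Gen.e j) : Lam K m) = if i = j then lam (Gen.e i) else 0 := by
  split_ifs with h
  · subst h
    simpa only [lam, gen, map_mul] using
      congrArg (lamHom K m) (gen_rel (PathRel.idem i))
  · simpa only [lam, gen, map_mul, map_zero] using
      congrArg (lamHom K m) (gen_rel (PathRel.orth i j h))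

theorem lam_e_mul_a (i : ZMod m) :
    (lam (Gen.e i) * lam (Gen.a i) : Lam K m) = lam (Gen.a i) := by
  simpa only [lam, gen, map_mul] using
    congrArg (lamHom K m) (gen_rel (PathRel.a_origin i))

theorem lam_a_mul_e (i : ZMod m) :
    (lam (Gen.a i) * lam (Gen.e (i + 1)) : Lam K m) = lam (Gen.a i) := by
  simpa only [lam, gen, map_mul] using
    congrArg (lamHom K m) (gen_rel (PathRel.a_terminus i))

theorem lam_e_mul_abar (i : ZMod m) :
    (lam (Gen.e (i + 1)) * lam (Gen.abar i) : Lam K m) = lam (Gen.abar i) := by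
  simpa only [lam, gen, map_mul] using
    congrArg (lamHom K m)
      (gen_rel (PathRel.abar_origin i))

theorem lam_abar_mul_e (i : ZMod m) :
    (lam (Gen.abar i) * lam (Gen.e i) : Lam K m) = lam (Gen.abar i) := by
  simpa only [lam, gen, map_mul] using
    congrArg (lamHom K m)
      (gen_rel (PathRel.abar_terminus i))

theorem lam_a_mul_a (i : ZMod m) :
    (lam (Gen.a i) * lam (Gen.a (i + 1)) : Lam K m) = 0 := by
  simpa only [lam, lamRel, map_mul, map_zero, map_sub] using lamHom_rel (IdealRel.aa i)

theorem lam_abar_mul_abar (i : ZMod m) :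
    (lam (Gen.abar (i - 1)) * lam (Gen.abar (i - 2)) : Lam K m) = 0 := by
  simpa only [lam, lamRel, map_mul, map_zero, map_sub] using lamHom_rel (IdealRel.abar_abar i)

theorem lam_a_mul_abar (i : ZMod m) :
    (lam (Gen.a i) * lam (Gen.abar i) : Lam K m) =
      lam (Gen.abar (i - 1)) * lam (Gen.a (i - 1)) := by
  rw [← sub_eq_zero]
  simpa only [lam, lamRel, map_mul, map_zero, map_sub] using lamHom_rel (IdealRel.third i)

/-- The element `a₀ ā₀` of `Λ`. -/
def z₀ : Lam K m := lam (Gen.a 0) * lam (Gen.abar 0)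

theorem gen_mul_z₀ (g : Gen m) :
    (lam g * z₀ : Lam K m) = arrowMat (K := K) true g 0 0 • z₀ := by
  cases g with
  | e i =>
    rw [z₀, ← lam_e_mul_a, ← mul_assoc, ← mul_assoc, lam_e_mul_e]
    by_cases h : i = 0 <;> simp [arrowMat, h]
  | a i =>
    rw [z₀, ← mul_assoc]
    by_cases h : i + 1 = 0
    · rw [← h, lam_a_mul_a]
      simp [arrowMat]
    · rw [← lam_a_mul_e i, ← lam_e_mul_a 0, mul_assoc (lam (Gen.a i)),
        ← mul_assoc (lam (Gen.e (i + 1))), lam_e_mul_e, if_neg h]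
      simp [arrowMat]
  | abar i =>
    by_cases h : i = 0
    · subst h
      have h1 := lam_a_mul_abar (K := K) (m := m) 1
      have h2 := lam_abar_mul_abar (K := K) (m := m) 2
      rw [sub_self] at h1 h2
      rw [show (2 : ZMod m) - 1 = 1 by ring] at h2
      rw [z₀, ← mul_assoc, ← h1, mul_assoc, h2]
      simp [arrowMat]
    · rw [z₀, ← lam_abar_mul_e, ← lam_e_mul_a, mul_assoc, ← mul_assoc (lam (Gen.e i)),
        ← mul_assoc (lam (Gen.e i)), lam_e_mul_e, if_neg h]
      simp [arrowMat]

theorem z₀_mul_gen (g : Gen m) :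
    (z₀ * lam g : Lam K m) = arrowMat (K := K) true g 0 0 • z₀ := by
  cases g with
  | e i =>
    rw [z₀, ← lam_abar_mul_e, mul_assoc, mul_assoc, lam_e_mul_e]
    by_cases h : 0 = i
    · simp [arrowMat, ← h]
    · simp [arrowMat, h, Ne.symm h]
  | a i =>
    by_cases h : 0 = i
    · subst h
      have h1 := lam_a_mul_abar (K := K) (m := m) 1
      have h2 := lam_a_mul_a (K := K) (m := m) 0
      rw [sub_self] at h1
      rw [zero_add] at h2
      rw [z₀, mul_assoc, ← h1, ← mul_assoc, h2]
      simp [arrowMat]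
    · rw [z₀, ← lam_abar_mul_e, ← lam_e_mul_a i, mul_assoc, mul_assoc,
        ← mul_assoc (lam (Gen.e 0)), lam_e_mul_e, if_neg h]
      simp [arrowMat]
  | abar i =>
    by_cases h : 0 = i + 1
    · have h2 := lam_abar_mul_abar (K := K) (m := m) 1
      rw [sub_self, show (1 : ZMod m) - 2 = i by linear_combination h] at h2
      rw [z₀, mul_assoc, h2]
      simp [arrowMat]
    · rw [z₀, ← lam_abar_mul_e 0, ← lam_e_mul_abar i, mul_assoc, mul_assoc,
        ← mul_assoc (lam (Gen.e 0)), lam_e_mul_e, if_neg h]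
      simp [arrowMat]

theorem arrowRep_prop (x : Lam K m) :
    arrowRep true x 1 0 = 0 ∧ arrowRep false x 1 0 = 0 ∧
      arrowRep false x 0 0 = arrowRep true x 1 1 ∧ arrowRep false x 1 1 = arrowRep true x 0 0 ∧
      x * z₀ = arrowRep true x 0 0 • z₀ ∧ z₀ * x = arrowRep true x 0 0 • z₀ := by
  induction x using lam_induction with
  | hgen g =>
    simp only [arrowRep_lam]
    refine ⟨?_, ?_, ?_, ?_, gen_mul_z₀ g, z₀_mul_gen g⟩ <;> cases g <;> simp [arrowMat]
  | hscalar c =>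
    simp only [AlgHom.commutes, Matrix.algebraMap_matrix_apply]
    simp [Algebra.smul_def, Algebra.commutes]
  | hadd x y hx hy =>
    obtain ⟨h1, h2, h3, h4, h5, h6⟩ := hx
    obtain ⟨k1, k2, k3, k4, k5, k6⟩ := hy
    simp only [map_add, Matrix.add_apply, add_mul, mul_add, add_smul]
    simp only [h1, h2, h3, h4, h5, h6, k1, k2, k3, k4, k5, k6, add_zero, and_self]
  | hmul x y hx hy =>
    obtain ⟨h1, h2, h3, h4, h5, h6⟩ := hx
    obtain ⟨k1, k2, k3, k4, k5, k6⟩ := hy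
    simp only [map_mul, Matrix.mul_apply, Fin.sum_univ_two]
    refine ⟨?_, ?_, ?_, ?_, ?_, ?_⟩
    · rw [h1, k1]; ring
    · rw [h2, k2]; ring
    · rw [h3, k3, k2, h1]; ring
    · rw [h4, k4, k1, h2]; ring
    · rw [mul_assoc, k5, mul_smul_comm, h5, smul_smul, k1, mul_zero, add_zero, mul_comm]
    · rw [← mul_assoc, h6, smul_mul_assoc, k6, smul_smul, k1, mul_zero, add_zero]

variable (K m)

/-- The `2`-cocycle representing `π`: the bilinear map `(x, y) ↦ α(x) β(y) a₀ ā₀` where `α(x)` is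
the coefficient of `a₀` in `x` and `β(y)` is the coefficient of `ā₀` in `y`. It takes the value
`a₀ ā₀` at the pair `(a₀, ā₀)` and vanishes at all other pairs of vertices and arrows, so its
value at `e₀ ⊗_{1,0} e₀` is `a₀ ā₀`, and its values at the other generators of `P²` are zero. -/
def piCocycle : Cocycle2 K (Lam K m) :=
  ⟨LinearMap.mk₂ K (fun x y => (arrowCoeff true x * arrowCoeff false y) • z₀)
    (fun x x' y => by simp [arrowCoeff, add_mul, add_smul])
    (fun c x y => by simp [arrowCoeff, smul_smul, mul_assoc])
    (fun x y y' => by simp [arrowCoeff, mul_add, add_smul])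
    (fun c x y => by simp [arrowCoeff, smul_smul, mul_left_comm]),
  by
    intro x y z
    obtain ⟨-, -, -, -, h5, -⟩ := arrowRep_prop x
    obtain ⟨-, -, g3, -, -, -⟩ := arrowRep_prop y
    obtain ⟨-, -, -, k4, -, k6⟩ := arrowRep_prop z
    simp only [LinearMap.mk₂_apply, arrowCoeff, map_mul, Matrix.mul_apply, Fin.sum_univ_two,
      mul_smul_comm, smul_mul_assoc, h5, k6, g3, k4, smul_smul, ← sub_smul, ← add_smul]
    convert zero_smul K (z₀ : Lam K m) using 2
    ring⟩

/-- The element `π` of `HH²(Λ)`. -/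
def piClass : HH2 K (Lam K m) := toHH2 (piCocycle K m)

end Quiver

end SocleDeformation

end

set_option linter.unusedSectionVars false

noncomputable section

/-! All the algebras with `c = 0` have one shape: the basis eᵢ, aᵢ, āᵢ, aᵢāᵢ and a single
parametrized rule āᵢ₋₁aᵢ₋₁ = sᵢ aᵢāᵢ. Here s = 1 gives Λ, s = q gives Λ_q, and sᵢ = 1 - t dᵢ gives
K𝒬/J. The isomorphism `modelEquiv` expresses this in coordinates, for every s, with zero entries
allowed.

If no sᵢ vanishes, the sum of the coefficients of the aᵢāᵢ is a nondegenerate linear form, so the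
algebra is self-injective. Its socle is the span of the aᵢāᵢ, and modulo that span the product no
longer depends on s (`isSocleDeformation_of_equiv`). If sᵢ = 0, then aᵢ₋₁ falls into the socle and
the quotient by the socle is too small (`ne_zero_of_quotient_soc_equiv`).

The case c ≠ 0 is excluded by commutative quotients. The cocycle identity along aᵢāᵢaᵢ forces cᵢ₊₁ =
-cᵢ, so one nonzero cᵢ makes all of them nonzero. A homomorphism from K𝒬/J to the commutative
algebra Kᵐ kills the aᵢ, hence by the relations every cᵢeᵢ, hence 1; but Λ/soc Λ does map to Kᵐ
(`eq_zero_of_quotient_soc_equiv`).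

Part (1) is thereby reduced to the equivalence of η ∈ Kπ with c = 0 (`mem_span_piClass_iff`). A
coboundary has c = 0 and dᵢ = pᵢ - pᵢ₋₁, so ∑ dᵢ is an invariant of the class, equal to 1 for π.
Conversely, if c = 0 and ∑ dᵢ = 0, such a p exists and yields a cochain whose coboundary is the
normalized cocycle.

For part (2), adding T times a bilinear map with values in the socle gives a deformation with
infinitesimal of type (0, d), and dᵢ = (1 - qᵢ)/t reaches every q. -/

namespace SocleDeformation

universe u v w

/-! ### The coordinate model and its isomorphism with the quotients of the path algebra -/

section Model

variable {K : Type u} [Field K] {m : ℕ} [NeZero m]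

/-- Coordinates with respect to the basis `eᵢ`, `aᵢ`, `āᵢ`, `aᵢ āᵢ` of the algebra with relations
`aᵢ aᵢ₊₁`, `āᵢ₋₁ āᵢ₋₂`, `sᵢ aᵢ āᵢ - āᵢ₋₁ aᵢ₋₁`. -/
def Model (_s : ZMod m → K) : Type u :=
  (ZMod m → K) × (ZMod m → K) × (ZMod m → K) × (ZMod m → K)

namespace Model

variable {s : ZMod m → K}

instance : AddCommGroup (Model s) :=
  inferInstanceAs (AddCommGroup ((ZMod m → K) × (ZMod m → K) × (ZMod m → K) × (ZMod m → K)))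

instance : Module K (Model s) :=
  inferInstanceAs (Module K ((ZMod m → K) × (ZMod m → K) × (ZMod m → K) × (ZMod m → K)))

instance : Module.Finite K (Model s) :=
  inferInstanceAs
    (Module.Finite K ((ZMod m → K) × (ZMod m → K) × (ZMod m → K) × (ZMod m → K)))

/-- The element with given coordinates. -/
def mk (E A B Z : ZMod m → K) : Model s := (E, A, B, Z)

/-- The coefficients of the vertices. -/
def E : Model s →ₗ[K] ZMod m → K := LinearMap.fst K _ _

/-- The coefficients of the `aᵢ`. -/
def A : Model s →ₗ[K] ZMod m → K := LinearMap.fst K _ _ ∘ₗ LinearMap.snd K _ _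

/-- The coefficients of the `āᵢ`. -/
def B : Model s →ₗ[K] ZMod m → K :=
  LinearMap.fst K _ _ ∘ₗ LinearMap.snd K _ _ ∘ₗ LinearMap.snd K _ _

/-- The coefficients of the `aᵢ āᵢ`. -/
def Z : Model s →ₗ[K] ZMod m → K :=
  LinearMap.snd K _ _ ∘ₗ LinearMap.snd K _ _ ∘ₗ LinearMap.snd K _ _

@[simp] theorem E_mk (E' A' B' Z' : ZMod m → K) : (mk E' A' B' Z' : Model s).E = E' := rfl
@[simp] theorem A_mk (E' A' B' Z' : ZMod m → K) : (mk E' A' B' Z' : Model s).A = A' := rfl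
@[simp] theorem B_mk (E' A' B' Z' : ZMod m → K) : (mk E' A' B' Z' : Model s).B = B' := rfl
@[simp] theorem Z_mk (E' A' B' Z' : ZMod m → K) : (mk E' A' B' Z' : Model s).Z = Z' := rfl

@[ext] theorem ext {x y : Model s} (hE : ∀ i, x.E i = y.E i) (hA : ∀ i, x.A i = y.A i)
    (hB : ∀ i, x.B i = y.B i) (hZ : ∀ i, x.Z i = y.Z i) : x = y :=
  Prod.ext (funext hE) (Prod.ext (funext hA) (Prod.ext (funext hB) (funext hZ)))

instance : Mul (Model s) where
  mul x y := mk (fun i => x.E i * y.E i) (fun i => x.E i * y.A i + x.A i * y.E (i + 1))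
    (fun i => x.E (i + 1) * y.B i + x.B i * y.E i)
    (fun i => x.E i * y.Z i + x.Z i * y.E i + x.A i * y.B i + s i * x.B (i - 1) * y.A (i - 1))

instance : One (Model s) where
  one := mk 1 0 0 0

@[simp] theorem E_mul (x y : Model s) (i : ZMod m) : (x * y).E i = x.E i * y.E i := rfl
@[simp] theorem A_mul (x y : Model s) (i : ZMod m) :
    (x * y).A i = x.E i * y.A i + x.A i * y.E (i + 1) := rfl
@[simp] theorem B_mul (x y : Model s) (i : ZMod m) :
    (x * y).B i = x.E (i + 1) * y.B i + x.B i * y.E i := rfl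
@[simp] theorem Z_mul (x y : Model s) (i : ZMod m) :
    (x * y).Z i =
      x.E i * y.Z i + x.Z i * y.E i + x.A i * y.B i + s i * x.B (i - 1) * y.A (i - 1) := rfl
@[simp] theorem E_one : (1 : Model s).E = 1 := rfl
@[simp] theorem A_one : (1 : Model s).A = 0 := rfl
@[simp] theorem B_one : (1 : Model s).B = 0 := rfl
@[simp] theorem Z_one : (1 : Model s).Z = 0 := rfl

/-- Associativity puts no condition on s: the factor sᵢ enters only products of two arrows, and a
product of three arrows is zero. -/
instance : Ring (Model s) :=
  { (inferInstance : AddCommGroup (Model s)) with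
    left_distrib := by intro x y z; ext i <;> simp <;> ring
    right_distrib := by intro x y z; ext i <;> simp <;> ring
    zero_mul := by intro x; ext i <;> simp
    mul_zero := by intro x; ext i <;> simp
    mul_assoc := by intro x y z; ext i <;> simp <;> ring
    one_mul := by intro x; ext i <;> simp
    mul_one := by intro x; ext i <;> simp }

instance : Algebra K (Model s) :=
  Algebra.ofModule (by intro c x y; ext i <;> simp <;> ring)
    (by intro c x y; ext i <;> simp <;> ring)

variable (s) in
/-- The images of the vertices and arrows. -/
def ofGen : Gen m → Model s
  | Gen.e i => mk (Pi.single i 1) 0 0 0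
  | Gen.a i => mk 0 (Pi.single i 1) 0 0
  | Gen.abar i => mk 0 0 (Pi.single i 1) 0

theorem ofGen_pathRel ⦃x y : FreeAlgebra K (Gen m)⦄ (h : PathRel K m x y) :
    FreeAlgebra.lift K (ofGen s) x = FreeAlgebra.lift K (ofGen s) y := by
  cases h with
  | one =>
    simp only [map_sum, map_one, FreeAlgebra.lift_ι_apply]
    ext k <;> simp [ofGen, Pi.single_apply]
  | idem i =>
    simp only [map_mul, FreeAlgebra.lift_ι_apply]
    ext k <;> simp [ofGen, Pi.single_apply]
  | orth i j h =>
    simp only [map_mul, FreeAlgebra.lift_ι_apply, map_zero]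
    ext k <;> simp [ofGen, Pi.single_apply]
    grind
  | a_origin i =>
    simp only [map_mul, FreeAlgebra.lift_ι_apply]
    ext k <;> simp [ofGen, Pi.single_apply]
  | a_terminus i =>
    simp only [map_mul, FreeAlgebra.lift_ι_apply]
    ext k <;> simp [ofGen, Pi.single_apply]
  | abar_origin i =>
    simp only [map_mul, FreeAlgebra.lift_ι_apply]
    ext k <;> simp [ofGen, Pi.single_apply]
  | abar_terminus i =>
    simp only [map_mul, FreeAlgebra.lift_ι_apply]
    ext k <;> simp [ofGen, Pi.single_apply]

variable (s) in
/-- The representation of the path algebra on the model. -/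
def ofPath : PathAlg K m →ₐ[K] Model s :=
  RingQuot.liftAlgHom K ⟨FreeAlgebra.lift K (ofGen s), ofGen_pathRel⟩

@[simp] theorem ofPath_gen (g : Gen m) : ofPath s (gen g) = ofGen s g := by
  simp [ofPath, gen]

end Model

/-- The relations `sᵢ aᵢ āᵢ - āᵢ₋₁ aᵢ₋₁`. -/
def IsScaledRel (s : ZMod m → K) (r : ZMod m → PathAlg K m) : Prop :=
  ∀ i, r i = s i • (gen (Gen.a i) * gen (Gen.abar i)) -
    gen (Gen.abar (i - 1)) * gen (Gen.a (i - 1))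

theorem isScaledRel_lamRel : IsScaledRel 1 (lamRel K m) := by
  intro i
  simp [lamRel]

theorem isScaledRel_lamQRel (q : ZMod m → Kˣ) : IsScaledRel (fun i => (q i : K)) (lamQRel q) :=
  fun _ => rfl

theorem isScaledRel_lamJRel (t : K) (d : ZMod m → K) :
    IsScaledRel (fun i => 1 - t * d i) (lamJRel t 0 d) := by
  intro i
  simp only [lamJRel, Pi.zero_apply, zero_smul, zero_add, sub_smul, one_smul, mul_smul]
  abel

/-- The image of a vertex or an arrow in a quotient of the path algebra. -/
def qgen (r : ZMod m → PathAlg K m) (g : Gen m) : QuotAlg r :=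
  RingQuot.mkAlgHom K (IdealRel r) (gen g)

theorem lam_eq_qgen (g : Gen m) : (lam g : Lam K m) = qgen (lamRel K m) g := rfl

section Table

variable (r : ZMod m → PathAlg K m)

theorem quotAlg_rel {x y : FreeAlgebra K (Gen m)} (h : PathRel K m x y) :
    RingQuot.mkAlgHom K (IdealRel r) (RingQuot.mkAlgHom K (PathRel K m) x) =
      RingQuot.mkAlgHom K (IdealRel r) (RingQuot.mkAlgHom K (PathRel K m) y) :=
  congrArg _ (gen_rel h)

theorem quotAlg_idealRel {x y : PathAlg K m} (h : IdealRel r x y) :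
    RingQuot.mkAlgHom K (IdealRel r) x = RingQuot.mkAlgHom K (IdealRel r) y :=
  RingQuot.mkAlgHom_rel K h

theorem sum_qgen_e : ∑ i, qgen r (Gen.e i) = 1 := by
  simpa only [qgen, gen, map_sum, map_one] using quotAlg_rel r PathRel.one

theorem qgen_e_mul_e (i j : ZMod m) :
    qgen r (Gen.e i) * qgen r (Gen.e j) = if j = i then qgen r (Gen.e i) else 0 := by
  split_ifs with h
  · subst h
    simpa only [qgen, gen, map_mul] using quotAlg_rel r (PathRel.idem j)
  · simpa only [qgen, gen, map_mul, map_zero] using quotAlg_rel r (PathRel.orth i j (Ne.symm h))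

theorem qgen_e_mul_a (i j : ZMod m) :
    qgen r (Gen.e i) * qgen r (Gen.a j) = if j = i then qgen r (Gen.a i) else 0 := by
  have h : qgen r (Gen.e j) * qgen r (Gen.a j) = qgen r (Gen.a j) := by
    simpa only [qgen, gen, map_mul] using quotAlg_rel r (PathRel.a_origin j)
  rw [← h, ← mul_assoc, qgen_e_mul_e, ite_mul, zero_mul]
  split_ifs with h'
  · rw [← h', h]
  · rfl

theorem qgen_a_mul_e (i j : ZMod m) :
    qgen r (Gen.a i) * qgen r (Gen.e j) = if j = i + 1 then qgen r (Gen.a i) else 0 := by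
  have h : qgen r (Gen.a i) * qgen r (Gen.e (i + 1)) = qgen r (Gen.a i) := by
    simpa only [qgen, gen, map_mul] using quotAlg_rel r (PathRel.a_terminus i)
  rw [← h, mul_assoc, qgen_e_mul_e, mul_ite, mul_zero, h]

theorem qgen_e_mul_abar (i j : ZMod m) :
    qgen r (Gen.e i) * qgen r (Gen.abar j) =
      if j = i - 1 then qgen r (Gen.abar (i - 1)) else 0 := by
  have h : qgen r (Gen.e (j + 1)) * qgen r (Gen.abar j) = qgen r (Gen.abar j) := by
    simpa only [qgen, gen, map_mul] using quotAlg_rel r (PathRel.abar_origin j)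
  rw [← h, ← mul_assoc, qgen_e_mul_e, ite_mul, zero_mul]
  by_cases h' : j = i - 1
  · rw [if_pos (by rw [h']; ring), if_pos h', ← h', show i = j + 1 by rw [h']; ring, h]
  · rw [if_neg h', if_neg (fun h2 => h' (eq_sub_of_add_eq h2))]

theorem qgen_abar_mul_e (i j : ZMod m) :
    qgen r (Gen.abar i) * qgen r (Gen.e j) = if j = i then qgen r (Gen.abar i) else 0 := by
  have h : qgen r (Gen.abar i) * qgen r (Gen.e i) = qgen r (Gen.abar i) := by
    simpa only [qgen, gen, map_mul] using quotAlg_rel r (PathRel.abar_terminus i)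
  rw [← h, mul_assoc, qgen_e_mul_e, mul_ite, mul_zero, h]

theorem qgen_a_mul_a (i j : ZMod m) : qgen r (Gen.a i) * qgen r (Gen.a j) = 0 := by
  by_cases h : j = i + 1
  · subst h
    simpa only [qgen, map_mul, map_zero] using quotAlg_idealRel r (IdealRel.aa i)
  · have h1 := qgen_a_mul_e r i (i + 1)
    rw [if_pos rfl] at h1
    rw [← h1, mul_assoc, qgen_e_mul_a, if_neg h, mul_zero]

theorem qgen_abar_mul_abar (i j : ZMod m) : qgen r (Gen.abar i) * qgen r (Gen.abar j) = 0 := by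
  by_cases h : j = i - 1
  · have h1 := quotAlg_idealRel r (IdealRel.abar_abar (i + 1))
    rw [add_sub_cancel_right, show i + 1 - 2 = j by rw [h]; ring] at h1
    simpa only [qgen, map_mul, map_zero] using h1
  · have h1 := qgen_abar_mul_e r i i
    rw [if_pos rfl] at h1
    rw [← h1, mul_assoc, qgen_e_mul_abar, if_neg h, mul_zero]

/-- The element `aᵢ āᵢ` of a quotient of the path algebra. -/
def qsoc (i : ZMod m) : QuotAlg r := qgen r (Gen.a i) * qgen r (Gen.abar i)

theorem qgen_a_mul_abar (i j : ZMod m) :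
    qgen r (Gen.a i) * qgen r (Gen.abar j) = if j = i then qsoc r i else 0 := by
  split_ifs with h
  · rw [h, qsoc]
  · have h1 := qgen_a_mul_e r i (i + 1)
    rw [if_pos rfl] at h1
    rw [← h1, mul_assoc, qgen_e_mul_abar, add_sub_cancel_right, if_neg h, mul_zero]

variable {r} {s : ZMod m → K}

/-- The only entry of the multiplication table that involves s. The relation used is the one at the
vertex i + 1, where āᵢaᵢ starts and ends. -/
theorem qgen_abar_mul_a (hr : IsScaledRel s r) (i j : ZMod m) :
    qgen r (Gen.abar i) * qgen r (Gen.a j) =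
      if j = i then s (i + 1) • qsoc r (i + 1) else 0 := by
  split_ifs with h
  · have h1 := quotAlg_idealRel r (IdealRel.third (i + 1))
    rw [hr, add_sub_cancel_right, map_sub, map_zero, sub_eq_zero] at h1
    rw [h]
    simpa only [qsoc, qgen, map_mul, map_smul] using h1.symm
  · have h1 := qgen_abar_mul_e r i i
    rw [if_pos rfl] at h1
    rw [← h1, mul_assoc, qgen_e_mul_a, if_neg h, mul_zero]

theorem qgen_e_mul_qsoc (i j : ZMod m) :
    qgen r (Gen.e i) * qsoc r j = if j = i then qsoc r i else 0 := by
  rw [qsoc, ← mul_assoc, qgen_e_mul_a, ite_mul, zero_mul]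
  split_ifs with h
  · rw [h, qsoc]
  · rfl

theorem qgen_a_mul_qsoc (i j : ZMod m) : qgen r (Gen.a i) * qsoc r j = 0 := by
  rw [qsoc, ← mul_assoc, qgen_a_mul_a, zero_mul]

theorem qgen_abar_mul_qsoc (hr : IsScaledRel s r) (i j : ZMod m) :
    qgen r (Gen.abar i) * qsoc r j = 0 := by
  rw [qsoc, ← mul_assoc, qgen_abar_mul_a hr, ite_mul, zero_mul, smul_mul_assoc, qsoc, mul_assoc,
    qgen_abar_mul_abar, mul_zero, smul_zero, ite_self]

end Table

section Equiv

variable {r : ZMod m → PathAlg K m} {s : ZMod m → K}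

theorem ofPath_idealRel (hr : IsScaledRel s r) ⦃x y : PathAlg K m⦄ (h : IdealRel r x y) :
    Model.ofPath s x = Model.ofPath s y := by
  cases h with
  | aa i =>
    simp only [map_mul, map_zero, Model.ofPath_gen]
    ext k <;> simp [Model.ofGen]
  | abar_abar i =>
    simp only [map_mul, map_zero, Model.ofPath_gen]
    ext k <;> simp [Model.ofGen]
  | third i =>
    simp only [hr i, map_mul, map_zero, map_sub, map_smul, Model.ofPath_gen]
    ext k <;> simp [Model.ofGen, Pi.single_apply]
    grind

/-- The representation on the model. -/
def toModel (hr : IsScaledRel s r) : QuotAlg r →ₐ[K] Model s :=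
  RingQuot.liftAlgHom K ⟨Model.ofPath s, ofPath_idealRel hr⟩

@[simp] theorem toModel_qgen (hr : IsScaledRel s r) (g : Gen m) :
    toModel hr (qgen r g) = Model.ofGen s g := by
  simp [toModel, qgen]

theorem quotAlg_induction {P : QuotAlg r → Prop} (hgen : ∀ g, P (qgen r g))
    (hscalar : ∀ c : K, P (algebraMap K (QuotAlg r) c))
    (hadd : ∀ x y, P x → P y → P (x + y)) (hmul : ∀ x y, P x → P y → P (x * y)) (x : QuotAlg r) :
    P x := by
  obtain ⟨x, rfl⟩ := RingQuot.mkAlgHom_surjective K _ x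
  obtain ⟨x, rfl⟩ := RingQuot.mkAlgHom_surjective K _ x
  induction x using FreeAlgebra.induction with
  | grade0 c => simpa only [AlgHom.commutes] using hscalar c
  | grade1 g => exact hgen g
  | mul x y hx hy => simpa only [map_mul] using hmul _ _ hx hy
  | add x y hx hy => simpa only [map_add] using hadd _ _ hx hy

variable (r s) in
/-- The element with given coordinates. -/
def fromModel : Model s →ₗ[K] QuotAlg r where
  toFun x := ∑ i, x.E i • qgen r (Gen.e i) + ∑ i, x.A i • qgen r (Gen.a i) +
    ∑ i, x.B i • qgen r (Gen.abar i) + ∑ i, x.Z i • qsoc r i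
  map_add' x y := by
    simp only [map_add, Pi.add_apply, add_smul, Finset.sum_add_distrib]
    abel
  map_smul' c x := by
    simp only [map_smul, Pi.smul_apply, smul_eq_mul, mul_smul, ← Finset.smul_sum, ← smul_add,
      RingHom.id_apply]

theorem fromModel_apply (x : Model s) : fromModel r s x =
    ∑ i, x.E i • qgen r (Gen.e i) + ∑ i, x.A i • qgen r (Gen.a i) +
    ∑ i, x.B i • qgen r (Gen.abar i) +
    ∑ i, x.Z i • qsoc r i := rfl

theorem qgen_mul_fromModel (hr : IsScaledRel s r) (g : Gen m) (x : Model s) :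
    qgen r g * fromModel r s x = fromModel r s (Model.ofGen s g * x) := by
  cases g with
  | e j =>
    simp only [fromModel_apply, mul_add, Finset.mul_sum, mul_smul_comm,
      qgen_e_mul_e, qgen_e_mul_a, qgen_e_mul_abar, qgen_e_mul_qsoc]
    simp [Model.ofGen, Pi.single_apply, ite_smul, ← eq_sub_iff_add_eq]
  | a j =>
    simp only [fromModel_apply, mul_add, Finset.mul_sum, mul_smul_comm,
      qgen_a_mul_e, qgen_a_mul_a, qgen_a_mul_abar, qgen_a_mul_qsoc]
    simp [Model.ofGen, Pi.single_apply, ite_smul]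
  | abar j =>
    simp only [fromModel_apply, mul_add, Finset.mul_sum, mul_smul_comm,
      qgen_abar_mul_e, qgen_abar_mul_a hr, qgen_abar_mul_abar, qgen_abar_mul_qsoc hr]
    simp [Model.ofGen, Pi.single_apply, ite_smul, sub_eq_iff_eq_add, smul_smul, mul_comm]

/-- Compatibility with left multiplication needs checking on generators only. Evaluated at x = 1 it
shows that `fromModel` is a left inverse of `toModel`, so the spanning property of the basis needs
no separate proof. -/
theorem mul_fromModel (hr : IsScaledRel s r) (w : QuotAlg r) (x : Model s) :
    w * fromModel r s x = fromModel r s (toModel hr w * x) := by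
  induction w using quotAlg_induction generalizing x with
  | hgen g => rw [toModel_qgen, qgen_mul_fromModel hr]
  | hscalar c => rw [AlgHom.commutes, ← Algebra.smul_def, ← Algebra.smul_def, map_smul]
  | hadd w v hw hv => rw [add_mul, hw, hv, map_add, add_mul, map_add]
  | hmul w v hw hv => rw [mul_assoc, hv, hw, map_mul (toModel hr), mul_assoc]

theorem fromModel_one : fromModel r s 1 = 1 := by
  simp [fromModel_apply, sum_qgen_e]

theorem fromModel_toModel (hr : IsScaledRel s r) (w : QuotAlg r) :
    fromModel r s (toModel hr w) = w := by
  rw [← mul_one (toModel hr w), ← mul_fromModel, fromModel_one, mul_one]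

theorem toModel_fromModel (hr : IsScaledRel s r) (x : Model s) :
    toModel hr (fromModel r s x) = x := by
  simp only [fromModel_apply, map_add, map_sum, map_smul, qsoc, map_mul, toModel_qgen]
  ext i <;> simp [Model.ofGen, Pi.single_apply]

/-- The algebra with relations `aᵢ aᵢ₊₁`, `āᵢ₋₁ āᵢ₋₂`, `sᵢ aᵢ āᵢ - āᵢ₋₁ aᵢ₋₁` is isomorphic to the
model. -/
def modelEquiv (hr : IsScaledRel s r) : QuotAlg r ≃ₐ[K] Model s :=
  { toModel hr with
    invFun := fromModel r s
    left_inv := fromModel_toModel hr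
    right_inv := toModel_fromModel hr }

@[simp] theorem modelEquiv_qgen (hr : IsScaledRel s r) (g : Gen m) :
    modelEquiv hr (qgen r g) = Model.ofGen s g :=
  toModel_qgen hr g

end Equiv

end Model

/-! ### Self-injectivity and socles of general algebras -/

section Socle

variable {K : Type u} {A : Type v} {B : Type w} [Field K] [Ring A] [Ring B] [Algebra K A]
  [Algebra K B]

/-- A finite-dimensional algebra with a linear form whose kernel contains no nonzero left ideal is
self-injective. -/
theorem injective_of_form [Module.Finite K A] (l : A →ₗ[K] K)
    (hl : ∀ x, (∀ y, l (y * x) = 0) → x = 0) : Module.Injective A A := by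
  refine Module.Baer.injective fun I g => ?_
  -- The map x ↦ l(· x) is injective by hypothesis, hence bijective onto the dual space by
  -- dimension.
  let T : A →ₗ[K] Module.Dual K A := (LinearMap.mul K A).flip.compr₂ l
  have hT : ∀ x y, T x y = l (y * x) := fun x y => rfl
  have hinj : Function.Injective T := by
    refine (injective_iff_map_eq_zero T).2 fun x hx => hl x fun y => ?_
    rw [← hT, hx, LinearMap.zero_apply]
  have hsurj : Function.Surjective T :=
    (LinearMap.injective_iff_surjective_of_finrank_eq_finrank Subspace.dual_finrank_eq.symm).1 hinj
  let g₀ : I.restrictScalars K →ₗ[K] A := g.restrictScalars K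
  -- Extend l ∘ g to a linear form on A and write it as l(· a). Right multiplication by a then
  -- extends g, because l(y(xa - g x)) = 0 for all y.
  obtain ⟨H, hH⟩ := LinearMap.exists_extend (l ∘ₗ g₀)
  obtain ⟨a, ha⟩ := hsurj H
  refine ⟨LinearMap.toSpanSingleton A A a, fun x hx => ?_⟩
  rw [LinearMap.toSpanSingleton_apply, smul_eq_mul, ← sub_eq_zero]
  refine hl _ fun y => ?_
  have h1 : l (y * (x * a)) = H (y * x) := by rw [← ha, hT, mul_assoc]
  have h2 : H (y * x) = l (g ⟨y * x, I.mul_mem_left y hx⟩) :=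
    LinearMap.congr_fun hH ⟨y * x, I.mul_mem_left y hx⟩
  have h3 : g ⟨y * x, I.mul_mem_left y hx⟩ = y * g ⟨x, hx⟩ := g.map_smul y ⟨x, hx⟩
  rw [mul_sub, map_sub, h1, h2, h3, sub_self]

theorem soc_le_comap (e : A ≃+* B) : soc A ≤ (soc B).comap e := by
  refine sSup_le fun I hI => ?_
  have h1 : IsAtom (e.idealComapOrderIso.symm I) :=
    (OrderIso.isAtom_iff _ _).2 (isSimpleModule_iff_isAtom.1 hI)
  have h2 : e.idealComapOrderIso.symm I ≤ soc B := le_sSup (isSimpleModule_iff_isAtom.2 h1)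
  rw [RingEquiv.idealComapOrderIso_symm_apply] at h2
  exact fun x hx => h2 (Ideal.mem_map_of_mem e hx)

theorem map_mem_soc_iff (e : A ≃+* B) (x : A) : e x ∈ soc B ↔ x ∈ soc A := by
  refine ⟨fun h => ?_, fun h => soc_le_comap e h⟩
  simpa using soc_le_comap e.symm h

/-- An isomorphism of algebras induces one modulo the socles. -/
def quotientSocCongr (e : A ≃ₐ[K] B) : (A ⧸ soc A) ≃ₐ[K] (B ⧸ soc B) :=
  Ideal.quotientEquivAlg _ _ e (by
    refine le_antisymm (fun y hy => ?_) (Ideal.map_le_iff_le_comap.2 (soc_le_comap e.toRingEquiv))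
    rw [← e.apply_symm_apply y]
    exact Ideal.mem_map_of_mem (e : A →+* B) ((map_mem_soc_iff e.symm.toRingEquiv y).2 hy))

/-- If r v ≠ 0 for some v in a minimal left ideal, then r v generates that ideal, so v = y r v for
some y. Iterating gives v = (y r)ⁿ v, against nilpotency. -/
theorem mul_eq_zero_of_mem_soc {r x : A} (hr : ∀ y, IsNilpotent (y * r)) (hx : x ∈ soc A) :
    r * x = 0 := by
  -- Quantifying over all left multiples turns the right annihilator of r into a left ideal, which
  -- can be compared with the minimal ones.
  let N : Ideal A :=
    { carrier := {x | ∀ a, r * (a * x) = 0}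
      zero_mem' := by simp
      add_mem' := fun hx hy a => by rw [mul_add, mul_add, hx a, hy a, add_zero]
      smul_mem' := fun c x hx a => by rw [smul_eq_mul, ← mul_assoc a, hx] }
  suffices h : soc A ≤ N by simpa using h hx 1
  refine sSup_le fun I hI x hx a => ?_
  by_contra hne
  have hI' : IsAtom I := isSimpleModule_iff_isAtom.1 hI
  have hx' : a * x ∈ I := I.mul_mem_left a hx
  have hle : Ideal.span {r * (a * x)} ≤ I :=
    (Ideal.span_singleton_le_iff_mem I).2 (I.mul_mem_left r hx')
  have heq : Ideal.span {r * (a * x)} = I :=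
    (hI'.le_iff_eq (by simpa [Ideal.span_singleton_eq_bot] using hne)).1 hle
  rw [← heq, Ideal.mem_span_singleton'] at hx'
  obtain ⟨y, hy⟩ := hx'
  rw [← mul_assoc] at hy
  have hn : ∀ n : ℕ, (y * r) ^ n * (a * x) = a * x := by
    intro n
    induction n with
    | zero => rw [pow_zero, one_mul]
    | succ n ih => rw [pow_succ, mul_assoc, hy, ih]
  obtain ⟨n, h0⟩ := hr y
  have h1 := hn n
  rw [h0, zero_mul] at h1
  rw [← h1, mul_zero] at hne
  exact hne rfl

theorem mem_soc_of_mul_eq_smul {x : A} (h : ∀ y, ∃ c : K, y * x = c • x) : x ∈ soc A := by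
  by_cases hx : x = 0
  · rw [hx]
    exact zero_mem _
  have hs : IsAtom (Ideal.span {x}) := by
    refine ⟨by simpa [Ideal.span_singleton_eq_bot] using hx, fun J hJ => ?_⟩
    by_contra hne
    obtain ⟨z, hz, hz0⟩ := J.ne_bot_iff.1 hne
    obtain ⟨y, rfl⟩ := Ideal.mem_span_singleton'.1 (hJ.le hz)
    obtain ⟨c, hc⟩ := h y
    rw [hc] at hz hz0
    have hc0 : c ≠ 0 := by
      rintro rfl
      exact hz0 (zero_smul _ _)
    have hxJ : x ∈ J := by
      have h1 := J.mul_mem_left (algebraMap K A c⁻¹) hz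
      rwa [← Algebra.smul_def, smul_smul, inv_mul_cancel₀ hc0, one_smul] at h1
    exact hJ.not_ge ((Ideal.span_singleton_le_iff_mem J).2 hxJ)
  exact (le_sSup (isSimpleModule_iff_isAtom.2 hs) : _ ≤ soc A) (Ideal.mem_span_singleton_self x)

end Socle

/-! ### The socle and the linear form of the model -/

namespace Model

variable {K : Type u} [Field K] {m : ℕ} [NeZero m] {s : ZMod m → K}

theorem isNilpotent_of_E_eq_zero {x : Model s} (hx : x.E = 0) : IsNilpotent x := by
  refine ⟨3, ?_⟩
  rw [pow_succ, pow_two]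
  ext i <;> simp [hx]

variable (s) in
/-- The span of the elements `aᵢ āᵢ`. -/
def socPart : Submodule K (Model s) :=
  LinearMap.ker E ⊓ (LinearMap.ker A ⊓ LinearMap.ker B)

theorem mem_socPart {x : Model s} : x ∈ socPart s ↔ x.E = 0 ∧ x.A = 0 ∧ x.B = 0 := by
  simp [socPart]

/-- Each aᵢāᵢ spans a left ideal of dimension one. Zero entries of s are allowed, which the
dimension count for degenerate s relies on. -/
theorem mem_soc_of_mem_socPart {x : Model s} (hx : x ∈ socPart s) : x ∈ soc (Model s) := by
  obtain ⟨h1, h2, h3⟩ := mem_socPart.1 hx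
  have h : x = ∑ i, mk 0 0 0 (Pi.single i (x.Z i)) := by
    ext i <;> simp [h1, h2, h3, Pi.single_apply]
  rw [h]
  refine sum_mem fun i _ => mem_soc_of_mul_eq_smul (K := K) fun y => ⟨y.E i, ?_⟩
  ext j <;> simp [Pi.single_apply]
  grind

/-- Arrows generate nil left ideals, so they annihilate the socle from the left. The coordinates of
āᵢx contain `x.E i` and s(i+1) times `x.A i`, and those of aᵢx contain `x.B i`. -/
theorem mem_socPart_of_mem_soc (hs : ∀ i, s i ≠ 0) {x : Model s} (hx : x ∈ soc (Model s)) :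
    x ∈ socPart s := by
  have ha : ∀ i, ofGen s (Gen.a i) * x = 0 := fun i =>
    mul_eq_zero_of_mem_soc (fun y => isNilpotent_of_E_eq_zero (by ext; simp [ofGen])) hx
  have hb : ∀ i, ofGen s (Gen.abar i) * x = 0 := fun i =>
    mul_eq_zero_of_mem_soc (fun y => isNilpotent_of_E_eq_zero (by ext; simp [ofGen])) hx
  refine mem_socPart.2 ⟨funext fun i => ?_, funext fun i => ?_, funext fun i => ?_⟩
  · simpa [ofGen] using congrFun (congrArg B (hb i)) i
  · simpa [ofGen, hs] using congrFun (congrArg Z (hb i)) (i + 1)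
  · simpa [ofGen] using congrFun (congrArg Z (ha i)) i

theorem mem_soc_iff (hs : ∀ i, s i ≠ 0) {x : Model s} : x ∈ soc (Model s) ↔ x ∈ socPart s :=
  ⟨mem_socPart_of_mem_soc hs, mem_soc_of_mem_socPart⟩

/-- The identity on coordinates. -/
def recast (s s' : ZMod m → K) : Model s ≃ₗ[K] Model s' := LinearEquiv.refl K (Model s)

@[simp] theorem E_recast (s' : ZMod m → K) (x : Model s) : (recast s s' x).E = x.E := rfl
@[simp] theorem A_recast (s' : ZMod m → K) (x : Model s) : (recast s s' x).A = x.A := rfl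
@[simp] theorem B_recast (s' : ZMod m → K) (x : Model s) : (recast s s' x).B = x.B := rfl
@[simp] theorem Z_recast (s' : ZMod m → K) (x : Model s) : (recast s s' x).Z = x.Z := rfl

variable (s) in
/-- The sum of the coefficients of the elements `aᵢ āᵢ`. -/
def form : Model s →ₗ[K] K := ∑ i, LinearMap.proj i ∘ₗ Z

theorem form_apply (x : Model s) : form s x = ∑ i, x.Z i := by simp [form]

/-- Left multiplication by aᵢāᵢ, āᵢ, aᵢ, eᵢ brings the coefficients of eᵢ, aᵢ, āᵢ, aᵢāᵢ respectively
into the socle; only the second picks up a factor, s(i+1). -/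
theorem eq_zero_of_form (hs : ∀ i, s i ≠ 0) (x : Model s) (h : ∀ y, form s (y * x) = 0) :
    x = 0 := by
  simp only [form_apply] at h
  ext i
  · simpa [Pi.single_apply] using h (mk 0 0 0 (Pi.single i 1))
  · simpa [Pi.single_apply, sub_eq_iff_eq_add, hs] using h (mk 0 0 (Pi.single i 1) 0)
  · simpa [Pi.single_apply] using h (mk 0 (Pi.single i 1) 0 0)
  · simpa [Pi.single_apply] using h (mk (Pi.single i 1) 0 0 0)

variable (s) in
/-- The projection to the semisimple quotient. -/
def toVertices : Model s →ₐ[K] ZMod m → K := AlgHom.ofLinearMap E rfl fun _ _ => rfl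

end Model

/-! ### Comparison with Λ modulo the socle -/

section

variable {K : Type u} [Field K] {m : ℕ} [NeZero m] {s : ZMod m → K} {A : Type w} [Ring A]
  [Algebra K A]

variable (K m) in
/-- The isomorphism of `Λ` with the model. -/
def lamEquiv : Lam K m ≃ₐ[K] Model (1 : ZMod m → K) := modelEquiv isScaledRel_lamRel

theorem mem_soc_lam {x : Lam K m} : x ∈ soc (Lam K m) ↔ lamEquiv K m x ∈ Model.socPart 1 := by
  rw [← map_mem_soc_iff (lamEquiv K m).toRingEquiv]
  exact Model.mem_soc_iff fun _ => one_ne_zero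

variable (s) in
/-- The coordinatewise projection of the model onto `Λ / soc Λ`. -/
def toLamModSoc : Model s →ₐ[K] (Lam K m ⧸ soc (Lam K m)) :=
  AlgHom.ofLinearMap
    ((Ideal.Quotient.mkₐ K (soc (Lam K m))).toLinearMap ∘ₗ
      (lamEquiv K m).symm.toLinearMap ∘ₗ (Model.recast s 1).toLinearMap)
    (by
      have h : Model.recast s 1 1 = 1 := rfl
      simp [h])
    (by
      intro x y
      simp only [LinearMap.comp_apply, LinearEquiv.coe_coe, AlgEquiv.toLinearMap_apply,
        AlgHom.toLinearMap_apply, ← map_mul]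
      -- The products for s and for 1 differ only in the coefficients of the aᵢāᵢ, that is, by an
      -- element of soc Λ.
      rw [Ideal.Quotient.mkₐ_eq_mk, Ideal.Quotient.mk_eq_mk_iff_sub_mem, mem_soc_lam, ← map_sub,
        AlgEquiv.apply_symm_apply, Model.mem_socPart]
      refine ⟨?_, ?_, ?_⟩ <;> ext i <;> simp)

theorem toLamModSoc_surjective : Function.Surjective (toLamModSoc s) :=
  (Ideal.Quotient.mkₐ_surjective K _).comp
    ((lamEquiv K m).symm.surjective.comp (Model.recast s 1).surjective)

theorem toLamModSoc_eq_zero_iff {x : Model s} :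
    toLamModSoc s x = 0 ↔ x ∈ Model.socPart s := by
  change Ideal.Quotient.mk _ ((lamEquiv K m).symm (Model.recast s 1 x)) = 0 ↔ _
  rw [Ideal.Quotient.eq_zero_iff_mem, mem_soc_lam, AlgEquiv.apply_symm_apply, Model.mem_socPart,
    Model.mem_socPart]
  simp

theorem isSocleDeformation_of_equiv (e : A ≃ₐ[K] Model s) (hs : ∀ i, s i ≠ 0) :
    IsSocleDeformation K A (Lam K m) := by
  have hfin : Module.Finite K A := Module.Finite.equiv e.symm.toLinearEquiv
  refine ⟨⟨hfin, injective_of_form (Model.form s ∘ₗ e.toLinearMap) fun x h => ?_⟩, ?_⟩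
  · refine (map_eq_zero_iff e e.injective).1 (Model.eq_zero_of_form hs _ fun y => ?_)
    simpa using h (e.symm y)
  · have hsurj : Function.Surjective ((toLamModSoc s).comp (e : A →ₐ[K] Model s)) :=
      toLamModSoc_surjective.comp e.surjective
    have hker : soc A = RingHom.ker ((toLamModSoc s).comp (e : A →ₐ[K] Model s)) := by
      ext x
      rw [RingHom.mem_ker, ← map_mem_soc_iff e.toRingEquiv]
      exact (Model.mem_soc_iff hs).trans toLamModSoc_eq_zero_iff.symm
    exact ⟨(Ideal.quotientEquivAlgOfEq K hker).trans
      (Ideal.quotientKerAlgEquivOfSurjective hsurj)⟩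

/-- The quotients by the socle and by the span of the aᵢāᵢ have equal dimension, so the socle is no
larger than that span. But sᵢ = 0 gives āᵢ₋₁aᵢ₋₁ = 0, which puts aᵢ₋₁ into the left socle. -/
theorem ne_zero_of_quotient_soc_equiv (e : A ≃ₐ[K] Model s)
    (g : (A ⧸ soc A) ≃ₐ[K] (Lam K m ⧸ soc (Lam K m))) (i : ZMod m) : s i ≠ 0 := by
  intro hi
  let p : Model s →ₗ[K] (Lam K m ⧸ soc (Lam K m)) :=
    g.toLinearMap ∘ₗ (Ideal.Quotient.mkₐ K (soc A)).toLinearMap ∘ₗ e.symm.toLinearMap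
  let p' : Model s →ₗ[K] (Lam K m ⧸ soc (Lam K m)) := (toLamModSoc s).toLinearMap
  have hp : ∀ x, p x = 0 ↔ x ∈ soc (Model s) := by
    intro x
    change g (Ideal.Quotient.mk (soc A) (e.symm x)) = 0 ↔ _
    rw [map_eq_zero_iff g g.injective, Ideal.Quotient.eq_zero_iff_mem]
    exact map_mem_soc_iff e.symm.toRingEquiv x
  have hsurj : Function.Surjective p :=
    g.surjective.comp ((Ideal.Quotient.mkₐ_surjective K _).comp e.symm.surjective)
  have hsurj' : Function.Surjective p' := toLamModSoc_surjective
  have hker' : LinearMap.ker p' = Model.socPart s := by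
    ext x
    exact toLamModSoc_eq_zero_iff
  have hle : Model.socPart s ≤ LinearMap.ker p := fun x hx =>
    LinearMap.mem_ker.2 ((hp x).2 (Model.mem_soc_of_mem_socPart hx))
  have h1 := LinearMap.finrank_range_add_finrank_ker p
  have h2 := LinearMap.finrank_range_add_finrank_ker p'
  rw [LinearMap.range_eq_top.2 hsurj] at h1
  rw [LinearMap.range_eq_top.2 hsurj', hker'] at h2
  have heq := Submodule.eq_of_le_of_finrank_eq hle (by omega)
  have ha : Model.ofGen s (Gen.a (i - 1)) ∈ Model.socPart s := by
    rw [heq, LinearMap.mem_ker, hp]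
    refine mem_soc_of_mul_eq_smul (K := K) fun y => ⟨y.E (i - 1), ?_⟩
    ext j <;> simp [Model.ofGen, Pi.single_apply]
    · grind
    · grind
  simpa [Model.ofGen] using congrFun (Model.mem_socPart.1 ha).2.1 (i - 1)

theorem eq_zero_of_quotient_soc_equiv (hm : 2 ≤ m) {t : K} (ht : t ≠ 0) {c d : ZMod m → K}
    (hc : ∀ i, c i + c (i - 1) = 0)
    (g : (LamJ t c d ⧸ soc (LamJ t c d)) ≃ₐ[K] (Lam K m ⧸ soc (Lam K m))) : c = 0 := by
  by_contra hne
  have hstep : ∀ i, c i = 0 → c (i + 1) = 0 := fun i hi => by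
    have h := hc (i + 1)
    rwa [add_sub_cancel_right, hi, add_zero] at h
  have hall : ∀ i, c i ≠ 0 := by
    intro i hi
    refine hne (funext fun j => ?_)
    have h : ∀ n : ℕ, c (i + n) = 0 := by
      intro n
      induction n with
      | zero => simpa using hi
      | succ n ih => simpa [add_assoc] using hstep _ ih
    simpa using h (j - i).val
  let χ : (Lam K m ⧸ soc (Lam K m)) →ₐ[K] ZMod m → K :=
    Ideal.Quotient.liftₐ (soc (Lam K m))
      ((Model.toVertices 1).comp (lamEquiv K m).toAlgHom)
      fun x hx => (Model.mem_socPart.1 (mem_soc_lam.1 hx)).1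
  -- The isomorphism modulo socles followed by the projection of Λ/soc Λ to its vertex coordinates;
  -- only commutativity and 1 ≠ 0 in the target matter.
  let θ : LamJ t c d →ₐ[K] ZMod m → K :=
    χ.comp ((g : _ →ₐ[K] _).comp (Ideal.Quotient.mkₐ K (soc (LamJ t c d))))
  have : Fact (1 < m) := ⟨hm⟩
  -- In a commutative target the image of aᵢ = eᵢaᵢeᵢ₊₁ contains the factor θ(eᵢeᵢ₊₁) = 0.
  have ha : ∀ i, θ (qgen _ (Gen.a i)) = 0 := by
    intro i
    have h1 := qgen_e_mul_a (lamJRel t c d) i i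
    have h2 := qgen_a_mul_e (lamJRel t c d) i (i + 1)
    have h3 := qgen_e_mul_e (lamJRel t c d) i (i + 1)
    rw [if_pos rfl] at h1 h2
    rw [if_neg (by simp)] at h3
    rw [← h2, ← h1, map_mul, map_mul, mul_right_comm, ← map_mul, h3, map_zero, zero_mul]
  -- Every product of arrows in the third relation contains some aⱼ, so only t cᵢ θ(eᵢ) = 0
  -- survives.
  have he : ∀ i, θ (qgen _ (Gen.e i)) = 0 := by
    intro i
    have h1 := quotAlg_idealRel (lamJRel t c d) (IdealRel.third i)
    simp only [lamJRel, map_sub, map_mul, map_smul, map_add, map_zero] at h1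
    have h2 := congrArg θ h1
    have hq : ∀ g, RingQuot.mkAlgHom K (IdealRel (lamJRel t c d)) (gen g) = qgen _ g :=
      fun _ => rfl
    simp only [hq, map_sub, map_mul, map_smul, map_add, map_zero, ha, zero_mul, mul_zero,
      smul_zero, add_zero, sub_zero, zero_sub, neg_eq_zero] at h2
    exact (smul_eq_zero_iff_right (hall i)).1 ((smul_eq_zero_iff_right ht).1 h2)
  have h1 : θ 1 = 0 := by
    rw [← sum_qgen_e, map_sum]
    exact Finset.sum_eq_zero fun i _ => he i
  rw [map_one] at h1
  exact one_ne_zero h1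

end

/-! ### Normalizing a cocycle at orthogonal idempotents -/

section Normalization

variable {K : Type u} {A : Type v} [Field K] [Ring A] [Algebra K A]

/-- The Hochschild coboundary of a linear map. -/
def coboundary (φ : A →ₗ[K] A) : A →ₗ[K] A →ₗ[K] A :=
  LinearMap.mk₂ K (fun x y => x * φ y - φ (x * y) + φ x * y)
    (fun x x' y => by simp only [map_add, add_mul]; abel)
    (fun c x y => by simp only [map_smul, smul_mul_assoc, smul_add, smul_sub])
    (fun x y y' => by simp only [map_add, mul_add]; abel)
    (fun c x y => by simp only [map_smul, mul_smul_comm, smul_add, smul_sub])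

@[simp] theorem coboundary_apply (φ : A →ₗ[K] A) (x y : A) :
    coboundary φ x y = x * φ y - φ (x * y) + φ x * y := rfl

theorem coboundary_mem (φ : A →ₗ[K] A) : coboundary φ ∈ Coboundary2 K A := ⟨φ, fun _ _ => rfl⟩

theorem mem_coboundary2_iff {f : A →ₗ[K] A →ₗ[K] A} :
    f ∈ Coboundary2 K A ↔ ∃ φ, f = coboundary φ :=
  ⟨fun ⟨φ, h⟩ => ⟨φ, LinearMap.ext₂ h⟩, fun ⟨φ, h⟩ => h ▸ coboundary_mem φ⟩

theorem sub_coboundary_mem {f : A →ₗ[K] A →ₗ[K] A} (hf : f ∈ Cocycle2 K A) (φ : A →ₗ[K] A) :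
    f - coboundary φ ∈ Cocycle2 K A :=
  sub_mem hf (coboundary2_le_cocycle2 (coboundary_mem φ))

theorem cocycle_left {f : A →ₗ[K] A →ₗ[K] A} (hf : f ∈ Cocycle2 K A) (x y z : A) :
    f (x * y) z = x * f y z + f x (y * z) - f x y * z := by
  rw [← sub_eq_zero, ← neg_eq_zero, ← hf x y z]
  abel

theorem cocycle_right {f : A →ₗ[K] A →ₗ[K] A} (hf : f ∈ Cocycle2 K A) (x y z : A) :
    f x (y * z) = f (x * y) z + f x y * z - x * f y z := by
  rw [cocycle_left hf]
  abel

theorem exists_sub_smul (f g : Cocycle2 K A) (k : K) :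
    ∃ F : Cocycle2 K A, (∀ x y, F.1 x y = f.1 x y - k • g.1 x y) ∧
      toHH2 F = toHH2 f - k • toHH2 g :=
  ⟨f - k • g, fun _ _ => rfl, by simp only [toHH2, map_sub, map_smul]⟩

theorem toHH2_eq_zero_iff (f : Cocycle2 K A) : toHH2 f = 0 ↔ f.1 ∈ Coboundary2 K A := by
  rw [toHH2, Submodule.mkQ_apply, Submodule.Quotient.mk_eq_zero]
  rfl

variable {ι : Type*} [Fintype ι] [DecidableEq ι] {e : ι → A}

/-- `f` vanishes if one of its arguments is one of the `e i`. -/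
def IsNormalized (e : ι → A) (f : A →ₗ[K] A →ₗ[K] A) : Prop :=
  ∀ i x, f (e i) x = 0 ∧ f x (e i) = 0

theorem exists_sub_coboundary_left (he : CompleteOrthogonalIdempotents e)
    {f : A →ₗ[K] A →ₗ[K] A} (hf : f ∈ Cocycle2 K A) :
    ∃ φ : A →ₗ[K] A, ∀ i x, (f - coboundary φ) (e i) x = 0 := by
  -- The cochain φ(x) = ∑ eᵢ f(eᵢ, x) satisfies δφ(eⱼ, x) = f(eⱼ, x).
  refine ⟨∑ i, LinearMap.mulLeft K (e i) ∘ₗ f (e i), fun j x => ?_⟩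
  have h1 : ∀ i, e i * f (e i) (e j * x) =
      e i * f (e i * e j) x + e i * (f (e i) (e j) * x) - e i * f (e j) x := by
    intro i
    rw [cocycle_right hf, mul_sub, mul_add, ← mul_assoc (e i) (e i), he.idem i]
  have h2 : ∑ i, e i * f (e i * e j) x = e j * f (e j) x := by
    rw [Finset.sum_eq_single j, he.idem j]
    · intro i _ hij
      rw [he.ortho hij, map_zero, LinearMap.zero_apply, mul_zero]
    · simp
  have h3 : e j * ∑ i, e i * f (e i) x = e j * f (e j) x := by
    rw [Finset.mul_sum, Finset.sum_eq_single j, ← mul_assoc, he.idem j]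
    · intro i _ hij
      rw [← mul_assoc, he.ortho hij.symm, zero_mul]
    · simp
  simp only [LinearMap.sub_apply, coboundary_apply, LinearMap.sum_apply, LinearMap.comp_apply,
    LinearMap.mulLeft_apply, h1, h3, Finset.sum_sub_distrib, Finset.sum_add_distrib, h2,
    ← Finset.sum_mul, he.complete, one_mul, ← mul_assoc]
  abel

theorem exists_sub_coboundary_right (he : CompleteOrthogonalIdempotents e)
    {f : A →ₗ[K] A →ₗ[K] A} (hf : f ∈ Cocycle2 K A) (hl : ∀ i x, f (e i) x = 0) :
    ∃ φ : A →ₗ[K] A, IsNormalized e (f - coboundary φ) := by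
  have h0 : ∀ i x y, f (e i * x) y = e i * f x y := by
    intro i x y
    rw [cocycle_left hf, hl, hl, zero_mul, add_zero, sub_zero]
  -- The mirror choice φ(x) = ∑ f(x, eᵢ) eᵢ. It commutes with left multiplication by the eⱼ and
  -- kills them, so the vanishing in the first argument is not destroyed.
  refine ⟨∑ i, LinearMap.mulRight K (e i) ∘ₗ f.flip (e i), fun j x => ⟨?_, ?_⟩⟩
  · simp only [LinearMap.sub_apply, coboundary_apply, LinearMap.sum_apply, LinearMap.comp_apply,
      LinearMap.mulRight_apply, LinearMap.flip_apply, h0, hl, zero_mul, Finset.sum_const_zero,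
      Finset.mul_sum, mul_assoc]
    abel
  · have h1 : ∀ i, f (x * e j) (e i) * e i = f x (e j * e i) * e i - f x (e j) * e i := by
      intro i
      rw [cocycle_left hf, hl, mul_zero, zero_add, sub_mul, mul_assoc, he.idem i]
    have h2 : ∑ i, f x (e j * e i) * e i = f x (e j) * e j := by
      rw [Finset.sum_eq_single j, he.idem j]
      · intro i _ hij
        rw [he.ortho hij.symm, map_zero, zero_mul]
      · simp
    have h3 : (∑ i, f x (e i) * e i) * e j = f x (e j) * e j := by
      rw [Finset.sum_mul, Finset.sum_eq_single j, mul_assoc, he.idem j]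
      · intro i _ hij
        rw [mul_assoc, he.ortho hij, mul_zero]
      · simp
    simp only [LinearMap.sub_apply, coboundary_apply, LinearMap.sum_apply, LinearMap.comp_apply,
      LinearMap.mulRight_apply, LinearMap.flip_apply, hl, zero_mul, Finset.sum_const_zero,
      mul_zero, h1, h3, Finset.sum_sub_distrib, h2, ← Finset.mul_sum, he.complete, mul_one]
    abel

theorem exists_isNormalized (he : CompleteOrthogonalIdempotents e)
    {f : A →ₗ[K] A →ₗ[K] A} (hf : f ∈ Cocycle2 K A) :
    ∃ φ : A →ₗ[K] A, IsNormalized e (f - coboundary φ) := by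
  obtain ⟨φ, hφ⟩ := exists_sub_coboundary_left he hf
  obtain ⟨ψ, hψ⟩ := exists_sub_coboundary_right he (sub_coboundary_mem hf φ) hφ
  refine ⟨φ + ψ, ?_⟩
  convert hψ using 1
  ext x y
  simp only [LinearMap.sub_apply, coboundary_apply, LinearMap.add_apply, mul_add, add_mul]
  abel

theorem IsNormalized.mul_left {f : A →ₗ[K] A →ₗ[K] A} (hf : f ∈ Cocycle2 K A)
    (hn : IsNormalized e f) (i : ι) (x y : A) : f (e i * x) y = e i * f x y := by
  rw [cocycle_left hf, (hn i _).1, (hn i _).1, zero_mul, add_zero, sub_zero]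

theorem IsNormalized.mul_right {f : A →ₗ[K] A →ₗ[K] A} (hf : f ∈ Cocycle2 K A)
    (hn : IsNormalized e f) (i : ι) (x y : A) : f x (y * e i) = f x y * e i := by
  rw [cocycle_right hf, (hn i _).2, (hn i _).2, mul_zero, zero_add, sub_zero]

theorem IsNormalized.mul_middle {f : A →ₗ[K] A →ₗ[K] A} (hf : f ∈ Cocycle2 K A)
    (hn : IsNormalized e f) (i : ι) (x y : A) : f (x * e i) y = f x (e i * y) := by
  rw [cocycle_left hf, (hn i _).1, (hn i _).2, mul_zero, zero_mul, zero_add, sub_zero]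

end Normalization

/-! ### Values of cocycles at the relations -/

section Values

variable {K : Type u} [Field K] {m : ℕ} [NeZero m]

@[simp] theorem lamEquiv_lam (g : Gen m) : lamEquiv K m (lam g) = Model.ofGen 1 g :=
  modelEquiv_qgen _ g

theorem lam_expand (x : Lam K m) : x =
    ∑ i, (lamEquiv K m x).E i • lam (Gen.e i) + ∑ i, (lamEquiv K m x).A i • lam (Gen.a i) +
    ∑ i, (lamEquiv K m x).B i • lam (Gen.abar i) +
    ∑ i, (lamEquiv K m x).Z i • (lam (Gen.a i) * lam (Gen.abar i)) :=
  ((lamEquiv K m).symm_apply_apply x).symm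

theorem lam_ext {x y : Lam K m} (hE : ∀ i, (lamEquiv K m x).E i = (lamEquiv K m y).E i)
    (hA : ∀ i, (lamEquiv K m x).A i = (lamEquiv K m y).A i)
    (hB : ∀ i, (lamEquiv K m x).B i = (lamEquiv K m y).B i)
    (hZ : ∀ i, (lamEquiv K m x).Z i = (lamEquiv K m y).Z i) : x = y :=
  (lamEquiv K m).injective (Model.ext hE hA hB hZ)

theorem completeOrthogonalIdempotents_lam_e :
    CompleteOrthogonalIdempotents (fun i : ZMod m => (lam (Gen.e i) : Lam K m)) where
  idem i := by rw [IsIdempotentElem, lam_e_mul_e, if_pos rfl]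
  ortho i j h := by simp only [lam_e_mul_e, if_neg h]
  complete := sum_qgen_e _

theorem natCast_zmod_ne_zero {n k : ℕ} (hk : 0 < k) (hn : k < n) : (k : ZMod n) ≠ 0 := by
  rw [Ne, ZMod.natCast_eq_zero_iff]
  exact fun h => absurd (Nat.le_of_dvd hk h) (by omega)

theorem add_one_ne (hm : 4 ≤ m) (j : ZMod m) : j + 1 ≠ j := by
  have h := natCast_zmod_ne_zero (n := m) (k := 1) (by omega) (by omega)
  rw [Nat.cast_one] at h
  exact fun h' => h (add_eq_left.1 h')

theorem add_two_ne (hm : 4 ≤ m) (j : ZMod m) : j + 1 + 1 ≠ j := by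
  have h := natCast_zmod_ne_zero (n := m) (k := 2) (by omega) (by omega)
  exact fun h' => h (by push_cast; linear_combination h')

theorem add_three_ne (hm : 4 ≤ m) (j : ZMod m) : j + 1 + 1 + 1 ≠ j := by
  have h := natCast_zmod_ne_zero (n := m) (k := 3) (by omega) (by omega)
  exact fun h' => h (by push_cast; linear_combination h')

theorem e_mul_mul_e_self (hm : 4 ≤ m) (i : ZMod m) (x : Lam K m) :
    lam (Gen.e i) * x * lam (Gen.e i) = (lamEquiv K m x).E i • lam (Gen.e i) +
      (lamEquiv K m x).Z i • (lam (Gen.a i) * lam (Gen.abar i)) := by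
  have h1 := add_one_ne hm
  apply lam_ext <;> intro j <;> simp [Model.ofGen, Pi.single_apply] <;> grind

/-- Since m ≥ 4, the vertex i + 2 is neither i nor i - 1, so no basis path joins i to i + 2. -/
theorem e_mul_mul_e_add_two (hm : 4 ≤ m) (i : ZMod m) (x : Lam K m) :
    lam (Gen.e i) * x * lam (Gen.e (i + 1 + 1)) = 0 := by
  have h2 := add_two_ne hm
  have h3 := add_three_ne hm
  apply lam_ext <;> intro j <;> simp [Model.ofGen, Pi.single_apply] <;> grind

theorem e_add_two_mul_mul_e (hm : 4 ≤ m) (i : ZMod m) (x : Lam K m) :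
    lam (Gen.e (i + 1 + 1)) * x * lam (Gen.e i) = 0 := by
  have h2 := add_two_ne hm
  have h3 := add_three_ne hm
  apply lam_ext <;> intro j <;> simp [Model.ofGen, Pi.single_apply] <;> grind

theorem hasValues_iff (hm : 4 ≤ m) (f : Cocycle2 K (Lam K m)) (c d : ZMod m → K) :
    HasValues f c d ↔ ∀ i, c i = (lamEquiv K m (valueAt f i)).E i ∧
      d i = (lamEquiv K m (valueAt f i)).Z i := by
  refine forall_congr' fun i => ⟨fun h => ?_, fun ⟨h1, h2⟩ => ?_⟩
  · rw [h]
    simp [Model.ofGen]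
  · rw [h1, h2, ← e_mul_mul_e_self hm]
    simp only [valueAt, mul_assoc, lam_e_mul_e, if_true]
    simp only [← mul_assoc, lam_e_mul_e, if_true]

theorem existsUnique_hasValues (hm : 4 ≤ m) (f : Cocycle2 K (Lam K m)) :
    ∃! p : (ZMod m → K) × (ZMod m → K), HasValues f p.1 p.2 := by
  simp only [hasValues_iff hm]
  refine ⟨(fun i => (lamEquiv K m (valueAt f i)).E i, fun i => (lamEquiv K m (valueAt f i)).Z i),
    fun i => ⟨rfl, rfl⟩, fun p hp => ?_⟩
  exact Prod.ext (funext fun i => (hp i).1) (funext fun i => (hp i).2)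

theorem HasValues.sub_smul {f g F : Cocycle2 K (Lam K m)} {c d c' d' : ZMod m → K} {k : K}
    (hf : HasValues f c d) (hg : HasValues g c' d')
    (hF : ∀ x y, F.1 x y = f.1 x y - k • g.1 x y) :
    HasValues F (c - k • c') (d - k • d') := by
  intro i
  have h : valueAt F i = valueAt f i - k • valueAt g i := by
    simp only [valueAt, hF]
    rw [← smul_mul_assoc, ← mul_smul_comm, ← sub_mul, ← mul_sub, smul_sub]
    congr 2
    abel
  rw [h, hf i, hg i]
  simp only [Pi.sub_apply, Pi.smul_apply, smul_eq_mul, _root_.sub_smul, smul_add, mul_smul]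
  abel

/-- The sum of the coefficients of `aᵢ` in `φ(aᵢ)` and of `āᵢ` in `φ(āᵢ)`. -/
def arrowTrace (φ : Lam K m →ₗ[K] Lam K m) (i : ZMod m) : K :=
  (lamEquiv K m (φ (lam (Gen.a i)))).A i + (lamEquiv K m (φ (lam (Gen.abar i)))).B i

/-- The two values of φ at the length-two paths cancel because these paths agree in Λ. What remains
are products with arrows, without vertex components, and the d-coefficients telescope around the
cycle. -/
theorem hasValues_coboundary (f : Cocycle2 K (Lam K m)) (φ : Lam K m →ₗ[K] Lam K m)
    (hf : f.1 = coboundary φ) :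
    HasValues f 0 (fun i => arrowTrace φ i - arrowTrace φ (i - 1)) := by
  intro i
  rw [valueAt, hf, coboundary_apply, coboundary_apply, lam_a_mul_abar i]
  apply lam_ext <;> intro j <;> simp [Model.ofGen, Pi.single_apply, arrowTrace]
  · grind
  · grind
  · grind

theorem hasValues_piCocycle : HasValues (piCocycle K m) 0 (Pi.single 0 1) := by
  intro i
  have h : ∀ x y, (piCocycle K m).1 x y = (arrowCoeff true x * arrowCoeff false y) • z₀ :=
    fun _ _ => rfl
  simp only [valueAt, h, arrowCoeff, arrowRep_lam]
  by_cases hi : i = 0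
  · subst hi
    apply lam_ext <;> intro j <;> (simp [Model.ofGen, Pi.single_apply, z₀, arrowMat]; try grind)
  · simp [hi, arrowMat]

theorem sum_sub_shift (p : ZMod m → K) : ∑ i, (p i - p (i - 1)) = 0 := by
  rw [Finset.sum_sub_distrib, sub_eq_zero]
  exact ((Equiv.subRight (1 : ZMod m)).sum_comp p).symm

theorem exists_sub_shift (d : ZMod m → K) (hd : ∑ i, d i = 0) :
    ∃ p : ZMod m → K, ∀ i, p i - p (i - 1) = d i := by
  let S : ℕ → K := fun n => ∑ j ∈ Finset.range n, d j
  have hS : S m = 0 := by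
    rw [← hd, show S m = ∑ j ∈ Finset.range m, d j from rfl,
      ← Fin.sum_univ_eq_sum_range (fun n => d (n : ZMod m)) m]
    obtain ⟨n, rfl⟩ := Nat.exists_eq_succ_of_ne_zero (NeZero.ne m)
    exact Fintype.sum_congr _ _ fun i => congrArg d (Fin.cast_val_eq_self i)
  refine ⟨fun i => S (i.val + 1), fun i => ?_⟩
  have hi : S (i.val + 1) = S i.val + d i := by
    simp only [S, Finset.sum_range_succ, ZMod.natCast_val, ZMod.cast_id]
  suffices h : S ((i - 1).val + 1) = S i.val by
    simp only [hi, h]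
    ring
  -- At i = 0 the partial sums wrap around: `(0 - 1).val + 1 = m`, and S m = 0 = S 0 is the
  -- hypothesis on the total sum.
  by_cases h0 : i = 0
  · subst h0
    obtain ⟨n, rfl⟩ := Nat.exists_eq_succ_of_ne_zero (NeZero.ne m)
    rw [zero_sub, ZMod.val_neg_one, hS, ZMod.val_zero]
    simp [S]
  · have h1 : 1 ≤ i.val := Nat.one_le_iff_ne_zero.2 ((ZMod.val_ne_zero i).2 h0)
    have h2 : (i - 1).val = i.val - 1 := by
      conv_lhs => rw [← ZMod.natCast_zmod_val i, ← Nat.cast_one, ← Nat.cast_sub h1]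
      exact ZMod.val_natCast_of_lt (by have := i.val_lt; omega)
    rw [h2, Nat.sub_add_cancel h1]

end Values

/-! ### Cohomology classes and their values -/

section Vanishing

variable {K : Type u} [Field K] {m : ℕ} [NeZero m]

/-- `f` vanishes if one of its arguments is a vertex. -/
abbrev IsVertexNormalized (f : Lam K m →ₗ[K] Lam K m →ₗ[K] Lam K m) : Prop :=
  IsNormalized (fun i : ZMod m => (lam (Gen.e i) : Lam K m)) f

variable {f : Lam K m →ₗ[K] Lam K m →ₗ[K] Lam K m}

theorem IsVertexNormalized.apply_mem (hf : f ∈ Cocycle2 K (Lam K m)) (hn : IsVertexNormalized f)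
    {i j : ZMod m} {x y : Lam K m} (hx : lam (Gen.e i) * x = x) (hy : y * lam (Gen.e j) = y) :
    f x y = lam (Gen.e i) * f x y * lam (Gen.e j) := by
  conv_lhs => rw [← hx, ← hy]
  rw [IsNormalized.mul_left hf hn, IsNormalized.mul_right hf hn, mul_assoc]

theorem IsVertexNormalized.apply_eq_zero (hf : f ∈ Cocycle2 K (Lam K m))
    (hn : IsVertexNormalized f) {i j : ZMod m} {x y : Lam K m} (hx : x * lam (Gen.e i) = x)
    (hy : lam (Gen.e j) * y = y) (hij : i ≠ j) : f x y = 0 := by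
  rw [← hx, ← hy, IsNormalized.mul_middle hf hn, ← mul_assoc, lam_e_mul_e, if_neg hij, zero_mul,
    map_zero]

theorem IsVertexNormalized.a_a (hm : 4 ≤ m) (hf : f ∈ Cocycle2 K (Lam K m))
    (hn : IsVertexNormalized f) (i j : ZMod m) : f (lam (Gen.a i)) (lam (Gen.a j)) = 0 := by
  by_cases h : i + 1 = j
  · subst h
    rw [hn.apply_mem hf (lam_e_mul_a i) (lam_a_mul_e (i + 1)), e_mul_mul_e_add_two hm]
  · exact hn.apply_eq_zero hf (lam_a_mul_e i) (lam_e_mul_a j) h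

theorem IsVertexNormalized.abar_abar (hm : 4 ≤ m) (hf : f ∈ Cocycle2 K (Lam K m))
    (hn : IsVertexNormalized f) (i j : ZMod m) :
    f (lam (Gen.abar i)) (lam (Gen.abar j)) = 0 := by
  by_cases h : i = j + 1
  · subst h
    rw [hn.apply_mem hf (lam_e_mul_abar (j + 1)) (lam_abar_mul_e j), e_add_two_mul_mul_e hm]
  · exact hn.apply_eq_zero hf (lam_abar_mul_e i) (lam_e_mul_abar j) h

theorem lam_a_mul_a' (i j : ZMod m) : (lam (Gen.a i) * lam (Gen.a j) : Lam K m) = 0 :=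
  qgen_a_mul_a _ i j

theorem lam_abar_mul_abar' (i j : ZMod m) :
    (lam (Gen.abar i) * lam (Gen.abar j) : Lam K m) = 0 :=
  qgen_abar_mul_abar _ i j

theorem lam_abar_mul_a (i : ZMod m) :
    (lam (Gen.abar i) * lam (Gen.a i) : Lam K m) =
      lam (Gen.a (i + 1)) * lam (Gen.abar (i + 1)) := by
  rw [lam_a_mul_abar, add_sub_cancel_right]

/-- A cocycle that vanishes on vertices and takes the value zero at all pairs of opposite arrows is
zero. -/
theorem IsVertexNormalized.eq_zero (hm : 4 ≤ m) (hf : f ∈ Cocycle2 K (Lam K m))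
    (hn : IsVertexNormalized f) (h1 : ∀ i, f (lam (Gen.a i)) (lam (Gen.abar i)) = 0)
    (h2 : ∀ i, f (lam (Gen.abar i)) (lam (Gen.a i)) = 0) : f = 0 := by
  have h1' : ∀ i j, f (lam (Gen.a i)) (lam (Gen.abar j)) = 0 := by
    intro i j
    by_cases h : i = j
    · rw [h, h1]
    · exact hn.apply_eq_zero hf (lam_a_mul_e i) (lam_e_mul_abar j) (by simpa using h)
  have h2' : ∀ i j, f (lam (Gen.abar i)) (lam (Gen.a j)) = 0 := by
    intro i j
    by_cases h : i = j
    · rw [h, h2]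
    · exact hn.apply_eq_zero hf (lam_abar_mul_e i) (lam_e_mul_a j) h
  have h3 : ∀ i j, f (lam (Gen.a i)) (lam (Gen.a j) * lam (Gen.abar j)) = 0 := by
    intro i j
    rw [cocycle_right hf, lam_a_mul_a', hn.a_a hm hf, h1, map_zero, LinearMap.zero_apply,
      zero_mul, mul_zero, add_zero, sub_zero]
  have h4 : ∀ i j, f (lam (Gen.abar i)) (lam (Gen.a j) * lam (Gen.abar j)) = 0 := by
    intro i j
    rw [cocycle_right hf, h2', h1, zero_mul, mul_zero, add_zero, sub_zero]
    by_cases h : i = j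
    · rw [h, lam_abar_mul_a, cocycle_left hf, hn.abar_abar hm hf, lam_abar_mul_abar', h1, map_zero,
        zero_mul, mul_zero, add_zero, sub_zero]
    · rw [← lam_abar_mul_e, ← lam_e_mul_a j, mul_assoc, ← mul_assoc (lam (Gen.e i)), lam_e_mul_e,
        if_neg h, zero_mul, mul_zero, map_zero, LinearMap.zero_apply]
  -- The cocycle identity reduces the first argument to generators; the second is expanded in the
  -- basis.
  ext x y
  rw [LinearMap.zero_apply, LinearMap.zero_apply]
  induction x using lam_induction generalizing y with
  | hgen g =>
    cases g with
    | e i => exact (hn i y).1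
    | a i =>
      rw [lam_expand y]
      simp only [map_add, map_sum, map_smul, (hn _ _).2, hn.a_a hm hf, h1', h3, smul_zero,
        Finset.sum_const_zero, add_zero]
    | abar i =>
      rw [lam_expand y]
      simp only [map_add, map_sum, map_smul, (hn _ _).2, hn.abar_abar hm hf, h2', h4, smul_zero,
        Finset.sum_const_zero, add_zero]
  | hscalar c =>
    rw [Algebra.algebraMap_eq_smul_one, ← completeOrthogonalIdempotents_lam_e.complete, map_smul,
      map_sum, LinearMap.smul_apply, LinearMap.sum_apply]
    simp only [(hn _ y).1, Finset.sum_const_zero, smul_zero]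
  | hadd x x' hx hx' => rw [map_add, LinearMap.add_apply, hx, hx', add_zero]
  | hmul x x' hx hx' =>
    rw [cocycle_left hf, hx, hx, hx', zero_mul, mul_zero, add_zero, sub_zero]

theorem IsVertexNormalized.valueAt_eq {f : Cocycle2 K (Lam K m)} (hn : IsVertexNormalized f.1)
    (i : ZMod m) : valueAt f i = f.1 (lam (Gen.a i)) (lam (Gen.abar i)) -
      f.1 (lam (Gen.abar (i - 1))) (lam (Gen.a (i - 1))) := by
  have h1 := lam_e_mul_abar (K := K) (i - 1)
  have h2 := lam_a_mul_e (K := K) (i - 1)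
  rw [sub_add_cancel] at h1 h2
  rw [valueAt, mul_sub, sub_mul, ← hn.apply_mem f.2 (lam_e_mul_a i) (lam_abar_mul_e i),
    ← hn.apply_mem f.2 h1 h2]

/-- The coefficients `cᵢ` of the values of a cocycle alternate. -/
theorem IsVertexNormalized.add_eq_zero (hm : 4 ≤ m) {f : Cocycle2 K (Lam K m)}
    (hn : IsVertexNormalized f.1) {c d : ZMod m → K} (hv : HasValues f c d) (i : ZMod m) :
    c (i + 1) + c i = 0 := by
  have h1 := hv (i + 1)
  have h2 := hv i
  rw [hn.valueAt_eq, add_sub_cancel_right] at h1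
  rw [hn.valueAt_eq] at h2
  -- Evaluate f(aᵢ, aᵢ₊₁āᵢ₊₁) in two ways, directly and through aᵢ₊₁āᵢ₊₁ = āᵢaᵢ. With aᵢāᵢ =
  -- āᵢ₋₁aᵢ₋₁ this gives aᵢ·(value at i + 1) + (value at i)·aᵢ = 0, whose coefficient of aᵢ is cᵢ₊₁
  -- + cᵢ.
  have h3 := cocycle_right f.2 (lam (Gen.a i)) (lam (Gen.a (i + 1))) (lam (Gen.abar (i + 1)))
  rw [lam_a_mul_a', hn.a_a hm f.2, map_zero, LinearMap.zero_apply, zero_mul, add_zero, zero_sub]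
    at h3
  have h4 := cocycle_right f.2 (lam (Gen.a i)) (lam (Gen.abar i)) (lam (Gen.a i))
  rw [lam_abar_mul_a, lam_a_mul_abar i] at h4
  have h5 := cocycle_left f.2 (lam (Gen.abar (i - 1))) (lam (Gen.a (i - 1))) (lam (Gen.a i))
  rw [lam_a_mul_a', hn.a_a hm f.2, map_zero, mul_zero, zero_add, zero_sub] at h5
  have h6 : lam (Gen.a i) * (c (i + 1) • lam (Gen.e (i + 1)) +
      d (i + 1) • (lam (Gen.a (i + 1)) * lam (Gen.abar (i + 1)))) +
      (c i • lam (Gen.e i) + d i • (lam (Gen.a i) * lam (Gen.abar i))) * lam (Gen.a i) =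
        (0 : Lam K m) := by
    rw [← h1, ← h2, mul_sub, sub_mul]
    rw [h3, h5] at h4
    rw [← sub_eq_zero] at h4
    rw [← neg_eq_zero, ← h4]
    abel
  simpa [Model.ofGen] using
    congrFun (congrArg (fun x : Lam K m => (lamEquiv K m x).A) h6) i

/-- Normalizing subtracts a coboundary, which leaves c alone and changes d by differences of total
sum zero. -/
theorem exists_normalized (f : Cocycle2 K (Lam K m)) {c d : ZMod m → K}
    (hv : HasValues f c d) :
    ∃ (F : Cocycle2 K (Lam K m)) (d' : ZMod m → K), IsVertexNormalized F.1 ∧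
      toHH2 F = toHH2 f ∧ HasValues F c d' ∧ ∑ i, d' i = ∑ i, d i := by
  obtain ⟨φ, hφ⟩ := exists_isNormalized completeOrthogonalIdempotents_lam_e f.2
  let g : Cocycle2 K (Lam K m) := ⟨coboundary φ, coboundary2_le_cocycle2 (coboundary_mem φ)⟩
  obtain ⟨F, hF, hF'⟩ := exists_sub_smul f g 1
  have hg : toHH2 g = 0 := (toHH2_eq_zero_iff g).2 (coboundary_mem φ)
  have hFφ : F.1 = f.1 - coboundary φ := by
    ext x y
    rw [hF, one_smul]
    rfl
  have hval := hv.sub_smul (hasValues_coboundary g φ rfl) hF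
  refine ⟨F, d - (1 : K) • (fun i => arrowTrace φ i - arrowTrace φ (i - 1)), ?_,
    by rw [hF', hg, smul_zero, sub_zero], ?_, ?_⟩
  rotate_left
  · rw [smul_zero, sub_zero] at hval
    exact hval
  · simp only [Pi.sub_apply, one_smul, Finset.sum_sub_distrib (f := d), sum_sub_shift, sub_zero]
  · rw [hFφ]
    exact hφ

theorem HasValues.add_eq_zero (hm : 4 ≤ m) {f : Cocycle2 K (Lam K m)} {c d : ZMod m → K}
    (hv : HasValues f c d) (i : ZMod m) : c i + c (i - 1) = 0 := by
  obtain ⟨F, d', hn, -, hF, -⟩ := exists_normalized f hv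
  simpa using hn.add_eq_zero hm hF (i - 1)

/-- The linear map with values `xᵢ aᵢ` at `aᵢ`, `wᵢ` at `aᵢ āᵢ`, and zero at `eᵢ` and `āᵢ`. -/
def rescale (x : ZMod m → K) (w : ZMod m → Lam K m) : Lam K m →ₗ[K] Lam K m :=
  (∑ i, (LinearMap.proj i ∘ₗ Model.A).smulRight (x i • lam (Gen.a i)) +
    ∑ i, (LinearMap.proj i ∘ₗ Model.Z).smulRight (w i)) ∘ₗ (lamEquiv K m).toLinearMap

theorem rescale_apply (x : ZMod m → K) (w : ZMod m → Lam K m) (y : Lam K m) :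
    rescale x w y = ∑ i, (lamEquiv K m y).A i • (x i • lam (Gen.a i)) +
      ∑ i, (lamEquiv K m y).Z i • w i := by
  simp [rescale, LinearMap.sum_apply]

/-- A cocycle whose values have `cᵢ = 0` and `∑ dᵢ = 0` is a coboundary. -/
theorem HasValues.toHH2_eq_zero (hm : 4 ≤ m) {f : Cocycle2 K (Lam K m)} {d : ZMod m → K}
    (hv : HasValues f 0 d) (hd : ∑ i, d i = 0) : toHH2 f = 0 := by
  obtain ⟨F, d', hn, hFf, hF, hd'⟩ := exists_normalized f hv
  rw [← hFf, toHH2_eq_zero_iff]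
  rw [hd] at hd'
  obtain ⟨x, hx⟩ := exists_sub_shift d' hd'
  have hval : ∀ i, F.1 (lam (Gen.a i)) (lam (Gen.abar i)) -
      F.1 (lam (Gen.abar (i - 1))) (lam (Gen.a (i - 1))) =
        d' i • (lam (Gen.a i) * lam (Gen.abar i)) := by
    intro i
    rw [← hn.valueAt_eq, hF i, Pi.zero_apply, zero_smul, zero_add]
  -- Chosen so that δφ(aᵢ, āᵢ) = xᵢ aᵢāᵢ - wᵢ equals F(aᵢ, āᵢ). Since xᵢ - xᵢ₋₁ = d'ᵢ, agreement at
  -- (āᵢ₋₁, aᵢ₋₁) is then automatic.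
  let w : ZMod m → Lam K m := fun i =>
    x i • (lam (Gen.a i) * lam (Gen.abar i)) - F.1 (lam (Gen.a i)) (lam (Gen.abar i))
  have hw : ∀ i, lam (Gen.e i) * w i = w i ∧ w i * lam (Gen.e i) = w i := by
    intro i
    have h := hn.apply_mem F.2 (lam_e_mul_a i) (lam_abar_mul_e i)
    constructor
    · simp only [w, mul_sub, mul_smul_comm]
      rw [← mul_assoc, lam_e_mul_a]
      congr 1
      rw [h, ← mul_assoc, ← mul_assoc, lam_e_mul_e, if_pos rfl]
    · simp only [w, sub_mul, smul_mul_assoc]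
      rw [mul_assoc, lam_abar_mul_e]
      congr 1
      rw [h, mul_assoc, lam_e_mul_e, if_pos rfl]
  let φ := rescale x w
  have he : ∀ i, φ (lam (Gen.e i)) = 0 := by
    intro i
    simp [φ, rescale_apply, Model.ofGen]
  have ha : ∀ i, φ (lam (Gen.a i)) = x i • lam (Gen.a i) := by
    intro i
    simp [φ, rescale_apply, Model.ofGen, Pi.single_apply]
  have hb : ∀ i, φ (lam (Gen.abar i)) = 0 := by
    intro i
    simp [φ, rescale_apply, Model.ofGen]
  have hz : ∀ i, φ (lam (Gen.a i) * lam (Gen.abar i)) = w i := by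
    intro i
    simp [φ, rescale_apply, Model.ofGen, Pi.single_apply]
  -- Commuting with the vertices and vanishing on them makes δφ normalized, so the vanishing
  -- criterion applies to F - δφ.
  have hl : ∀ i y, lam (Gen.e i) * φ y = φ (lam (Gen.e i) * y) := by
    intro i y
    have h1 : ∀ j, (lam (Gen.e i) * lam (Gen.a j) : Lam K m) =
        if j = i then lam (Gen.a i) else 0 := qgen_e_mul_a _ i
    have h2 : ∀ j, lam (Gen.e i) * w j = if j = i then w i else 0 := by
      intro j
      split_ifs with h
      · rw [h, (hw i).1]
      · rw [← (hw j).1, ← mul_assoc, lam_e_mul_e, if_neg (Ne.symm h), zero_mul]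
    simp [φ, rescale_apply, Model.ofGen, Pi.single_apply, mul_add, Finset.mul_sum, h1, h2]
  have hr : ∀ i y, φ y * lam (Gen.e i) = φ (y * lam (Gen.e i)) := by
    intro i y
    have h1 : ∀ j, (lam (Gen.a j) * lam (Gen.e i) : Lam K m) =
        if j = i - 1 then lam (Gen.a j) else 0 := by
      intro j
      rw [lam_eq_qgen, lam_eq_qgen, qgen_a_mul_e]
      simp only [eq_sub_iff_add_eq, eq_comm]
    have h2 : ∀ j, w j * lam (Gen.e i) = if j = i then w i else 0 := by
      intro j
      split_ifs with h
      · rw [h, (hw i).2]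
      · rw [← (hw j).2, mul_assoc, lam_e_mul_e, if_neg h, mul_zero]
    simp [φ, rescale_apply, Model.ofGen, Pi.single_apply, add_mul, Finset.sum_mul, h1, h2,
      ← eq_sub_iff_add_eq]
  have hG : F.1 - coboundary φ ∈ Cocycle2 K (Lam K m) := sub_coboundary_mem F.2 φ
  have hGn : IsVertexNormalized (F.1 - coboundary φ) := by
    intro i y
    constructor
    · rw [LinearMap.sub_apply, LinearMap.sub_apply, (hn i y).1, coboundary_apply, he, hl]
      simp
    · rw [LinearMap.sub_apply, LinearMap.sub_apply, (hn i y).2, coboundary_apply, he, hr]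
      simp
  have h1 : ∀ i, (F.1 - coboundary φ) (lam (Gen.a i)) (lam (Gen.abar i)) = 0 := by
    intro i
    rw [LinearMap.sub_apply, LinearMap.sub_apply, coboundary_apply, ha, hb, hz, mul_zero,
      smul_mul_assoc]
    simp only [w]
    abel
  have h2 : ∀ i, (F.1 - coboundary φ) (lam (Gen.abar (i - 1))) (lam (Gen.a (i - 1))) = 0 := by
    intro i
    rw [LinearMap.sub_apply, LinearMap.sub_apply, coboundary_apply, ha, hb, ← lam_a_mul_abar, hz,
      zero_mul, mul_smul_comm, ← lam_a_mul_abar]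
    have h := hval i
    rw [← hx i, _root_.sub_smul, ← sub_eq_zero] at h
    refine neg_eq_zero.1 (Eq.trans ?_ h)
    simp only [w]
    abel
  rw [mem_coboundary2_iff]
  refine ⟨φ, sub_eq_zero.1 (hGn.eq_zero hm hG h1 fun i => ?_)⟩
  simpa using h2 (i + 1)

/-- Both π and the coboundaries have c = 0. Conversely, subtracting (∑ dᵢ) π leaves a class with c =
0 and ∑ dᵢ = 0, which vanishes. -/
theorem mem_span_piClass_iff (hm : 4 ≤ m) {f : Cocycle2 K (Lam K m)} {c d : ZMod m → K}
    (hv : HasValues f c d) : toHH2 f ∈ Submodule.span K {piClass K m} ↔ c = 0 := by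
  rw [Submodule.mem_span_singleton]
  constructor
  · rintro ⟨k, hk⟩
    obtain ⟨F, hF, hF'⟩ := exists_sub_smul f (piCocycle K m) k
    rw [← hk, piClass, sub_self, toHH2_eq_zero_iff, mem_coboundary2_iff] at hF'
    obtain ⟨φ, hφ⟩ := hF'
    have h1 := hv.sub_smul hasValues_piCocycle hF
    have h2 := (existsUnique_hasValues hm F).unique (y₁ := (_, _)) (y₂ := (_, _)) h1
      (hasValues_coboundary F φ hφ)
    simpa using congrArg Prod.fst h2
  · rintro rfl
    refine ⟨∑ i, d i, ?_⟩
    obtain ⟨F, hF, hF'⟩ := exists_sub_smul f (piCocycle K m) (∑ i, d i)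
    have h1 := hv.sub_smul hasValues_piCocycle hF
    rw [smul_zero, sub_zero] at h1
    rw [h1.toHH2_eq_zero hm (by simp [← Finset.mul_sum])] at hF'
    exact (sub_eq_zero.1 hF'.symm).symm

end Vanishing

/-! ### Deforming the product inside the socle -/

section Deformation

variable {K : Type u} [Field K] {m : ℕ} [NeZero m]

/-- The bilinear map that sends `(āᵢ₋₁, aᵢ₋₁)` to `-dᵢ aᵢ āᵢ` and all other pairs of basis elements
to zero. -/
def socBilin (d : ZMod m → K) : Lam K m →ₗ[K] Lam K m →ₗ[K] Lam K m :=
  LinearMap.mk₂ K (fun x y => (lamEquiv K m).symm (Model.mk 0 0 0 fun i =>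
      -d i * (lamEquiv K m x).B (i - 1) * (lamEquiv K m y).A (i - 1)))
    (fun x x' y => by rw [← map_add]; congr 1; ext i <;> simp; ring)
    (fun c x y => by rw [← map_smul]; congr 1; ext i <;> simp; ring)
    (fun x y y' => by rw [← map_add]; congr 1; ext i <;> simp; ring)
    (fun c x y => by rw [← map_smul]; congr 1; ext i <;> simp; ring)

@[simp] theorem lamEquiv_socBilin (d : ZMod m → K) (x y : Lam K m) :
    lamEquiv K m (socBilin d x y) = Model.mk 0 0 0 fun i =>
      -d i * (lamEquiv K m x).B (i - 1) * (lamEquiv K m y).A (i - 1) :=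
  (lamEquiv K m).apply_symm_apply _

theorem socBilin_socBilin_left (d : ZMod m → K) (x y z : Lam K m) :
    socBilin d (socBilin d x y) z = 0 := by
  apply lam_ext <;> intro i <;> simp

theorem socBilin_socBilin_right (d : ZMod m → K) (x y z : Lam K m) :
    socBilin d x (socBilin d y z) = 0 := by
  apply lam_ext <;> intro i <;> simp

/-- The coefficients of the deformation of `Λ` given by the product
`x * y = x y + T • socBilin d x y`. -/
def socDeformationCoeff (d : ZMod m → K) : ℕ → Lam K m →ₗ[K] Lam K m →ₗ[K] Lam K m
  | 0 => LinearMap.mul K (Lam K m)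
  | 1 => socBilin d
  | _ + 2 => 0

theorem socDeformationCoeff_zero (d : ZMod m → K) (x y : Lam K m) :
    socDeformationCoeff d 0 x y = x * y := rfl

theorem socDeformationCoeff_one (d : ZMod m → K) : socDeformationCoeff d 1 = socBilin d := rfl

theorem socDeformationCoeff_eq_zero (d : ZMod m → K) {n : ℕ} (hn : 2 ≤ n) :
    socDeformationCoeff d n = 0 := by
  obtain ⟨k, rfl⟩ := Nat.exists_eq_add_of_le' hn
  rfl

/-- The formal deformation `x * y = x y + T • socBilin d x y` of `Λ`. -/
def socDeformation (d : ZMod m → K) : FormalDeformation K (Lam K m) where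
  μ := socDeformationCoeff d
  zero _ _ := rfl
  assoc n x y z := by
    rcases lt_or_ge n 2 with hn | hn
    · interval_cases n
      · simp [socDeformationCoeff_zero, mul_assoc]
      · simp only [Finset.Nat.antidiagonal_succ, Finset.Nat.antidiagonal_zero, Finset.sum_cons,
          Finset.map_singleton, Finset.sum_singleton, Function.Embedding.prodMap,
          Function.Embedding.coeFn_mk, Prod.map, Function.Embedding.refl_apply,
          Nat.succ_eq_add_one, zero_add, socDeformationCoeff_zero, socDeformationCoeff_one]
        apply lam_ext <;> intro i <;> simp
        ring
    -- From degree 2 on, the only pair of indices below 2 is (1, 1). Its terms vanish because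
    -- `socBilin` reads arrow coefficients only and its values have none.
    · have h : ∀ p ∈ Finset.HasAntidiagonal.antidiagonal n,
          socDeformationCoeff d p.1 (socDeformationCoeff d p.2 x y) z = 0 ∧
          socDeformationCoeff d p.1 x (socDeformationCoeff d p.2 y z) = 0 := by
        intro p hp
        rw [Finset.HasAntidiagonal.mem_antidiagonal] at hp
        by_cases h1 : 2 ≤ p.1
        · simp [socDeformationCoeff_eq_zero d h1]
        by_cases h2 : 2 ≤ p.2
        · simp [socDeformationCoeff_eq_zero d h2]
        rw [show p.1 = 1 by omega, show p.2 = 1 by omega]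
        exact ⟨socBilin_socBilin_left d x y z, socBilin_socBilin_right d x y z⟩
      rw [Finset.sum_eq_zero fun p hp => (h p hp).1, Finset.sum_eq_zero fun p hp => (h p hp).2]

/-- In coordinates, adding t times `socBilin d` turns the rule āᵢ₋₁aᵢ₋₁ = aᵢāᵢ of Λ into āᵢ₋₁aᵢ₋₁ =
(1 - t dᵢ) aᵢāᵢ. -/
theorem socDeformation_specializesTo (d : ZMod m → K) (t : K) :
    (socDeformation d).SpecializesTo t (LamJ t 0 d) := by
  refine ⟨2, fun n hn => socDeformationCoeff_eq_zero d hn,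
    ((lamEquiv K m).toLinearEquiv.trans (Model.recast 1 _)).trans
      (modelEquiv (isScaledRel_lamJRel t d)).symm.toLinearEquiv, fun x y => ?_⟩
  have h : ∑ n ∈ Finset.range 2, t ^ n • (socDeformation d).μ n x y =
      x * y + t • socBilin d x y := by
    rw [Finset.sum_range_succ, Finset.sum_range_one, pow_zero, one_smul, pow_one]
    rfl
  rw [h]
  apply (modelEquiv (isScaledRel_lamJRel t d)).injective
  simp only [LinearEquiv.trans_apply, AlgEquiv.toLinearEquiv_apply, map_mul,
    AlgEquiv.apply_symm_apply]
  ext i <;> simp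
  ring

theorem hasValues_socBilin (hm : 4 ≤ m) (d : ZMod m → K) (hd : socBilin d ∈ Cocycle2 K (Lam K m)) :
    HasValues ⟨socBilin d, hd⟩ 0 d := by
  rw [hasValues_iff hm]
  intro i
  simp [valueAt, Model.ofGen, Pi.single_apply]

theorem arisesFromFormalDeformation (hm : 4 ≤ m) {t : K} (d : ZMod m → K) {A : Type w} [Ring A]
    [Algebra K A] (e : A ≃ₐ[K] Model (fun i => 1 - t * d i)) :
    ArisesFromFormalDeformation K m t A :=
  ⟨socDeformation d, ⟨socBilin d, (socDeformation d).one_mem⟩, 0, d, rfl,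
    hasValues_socBilin hm d _, socDeformation_specializesTo d t,
    ⟨e.trans (modelEquiv (isScaledRel_lamJRel t d)).symm⟩⟩

/-- If `K𝒬 / J_η` and `Λ` agree modulo their socles, then `η(eᵢ ⊗ eᵢ) = dᵢ aᵢ āᵢ` with
`t dᵢ ≠ 1`. -/
theorem HasValues.of_quotient_soc_equiv (hm : 4 ≤ m) {t : K} (ht : t ≠ 0)
    {f : Cocycle2 K (Lam K m)} {c d : ZMod m → K} (hv : HasValues f c d)
    (g : (LamJ t c d ⧸ soc (LamJ t c d)) ≃ₐ[K] (Lam K m ⧸ soc (Lam K m))) :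
    c = 0 ∧ ∀ i, t * d i ≠ 1 := by
  have hc : c = 0 := eq_zero_of_quotient_soc_equiv (by omega) ht (hv.add_eq_zero hm) g
  subst hc
  refine ⟨rfl, fun i hi => ?_⟩
  exact ne_zero_of_quotient_soc_equiv (modelEquiv (isScaledRel_lamJRel t d)) g i
    (sub_eq_zero.2 hi.symm)

theorem isSocleDeformation_lamJ_iff (hm : 4 ≤ m) {t : K} (ht : t ≠ 0)
    {f : Cocycle2 K (Lam K m)} {c d : ZMod m → K} (hv : HasValues f c d) :
    IsSocleDeformation K (LamJ t c d) (Lam K m) ↔ c = 0 ∧ ∀ i, t * d i ≠ 1 := by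
  constructor
  · rintro ⟨-, ⟨g⟩⟩
    exact hv.of_quotient_soc_equiv hm ht g
  · rintro ⟨rfl, hd⟩
    exact isSocleDeformation_of_equiv (modelEquiv (isScaledRel_lamJRel t d)) fun i =>
      sub_ne_zero.2 (hd i).symm

end Deformation

end SocleDeformation

end

theorem mainTheorem3 {K : Type*} [Field K] (m : ℕ) [NeZero m] (hm : 4 ≤ m) (t : K) (ht : t ≠ 0) :
    (∀ f : SocleDeformation.Cocycle2 K (SocleDeformation.Lam K m),
      ∃! p : (ZMod m → K) × (ZMod m → K), SocleDeformation.HasValues f p.1 p.2) ∧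
    (∀ (η : SocleDeformation.HH2 K (SocleDeformation.Lam K m))
      (f : SocleDeformation.Cocycle2 K (SocleDeformation.Lam K m)) (c d : ZMod m → K),
      SocleDeformation.toHH2 f = η → SocleDeformation.HasValues f c d →
        ((∀ i, t * d i ≠ 1) →
          (SocleDeformation.IsSocleDeformation K
              (SocleDeformation.LamJ t c d) (SocleDeformation.Lam K m) ↔
            η ∈ Submodule.span K {SocleDeformation.piClass K m})) ∧
        ((∃ i, t * d i = 1) →
          ¬ SocleDeformation.IsSocleDeformation K
              (SocleDeformation.LamJ t c d) (SocleDeformation.Lam K m))) ∧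
    (∀ (A : Type*) [Ring A] [Algebra K A],
      (SocleDeformation.IsSocleDeformation K A (SocleDeformation.Lam K m) ∧
          SocleDeformation.ArisesFromFormalDeformation K m t A) ↔
        ∃ q : ZMod m → Kˣ, Nonempty (A ≃ₐ[K] SocleDeformation.LamQ q)) := by
  refine ⟨SocleDeformation.existsUnique_hasValues hm, ?_, ?_⟩
  · rintro η f c d rfl hv
    rw [SocleDeformation.isSocleDeformation_lamJ_iff hm ht hv,
      SocleDeformation.mem_span_piClass_iff hm hv]
    exact ⟨fun hd => and_iff_left hd, fun ⟨i, hi⟩ h => h.2 i hi⟩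
  · intro A _ _
    constructor
    · rintro ⟨⟨-, ⟨g⟩⟩, D, f, c, d, -, hv, -, ⟨e⟩⟩
      obtain ⟨rfl, hd⟩ :=
        hv.of_quotient_soc_equiv hm ht ((SocleDeformation.quotientSocCongr e).symm.trans g)
      have hq : ∀ i, 1 - t * d i ≠ 0 := fun i => sub_ne_zero.2 (hd i).symm
      exact ⟨fun i => Units.mk0 (1 - t * d i) (hq i),
        ⟨e.trans ((SocleDeformation.modelEquiv (SocleDeformation.isScaledRel_lamJRel t d)).trans
          (SocleDeformation.modelEquiv (SocleDeformation.isScaledRel_lamQRel _)).symm)⟩⟩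
    · rintro ⟨q, ⟨e⟩⟩
      have e' := e.trans
        (SocleDeformation.modelEquiv (SocleDeformation.isScaledRel_lamQRel q))
      refine ⟨SocleDeformation.isSocleDeformation_of_equiv e' fun i => (q i).ne_zero, ?_⟩
      -- The choice dᵢ = (1 - qᵢ)/t solves 1 - t dᵢ = qᵢ; this uses t ≠ 0.
      have hq : (fun i => (q i : K)) = fun i => 1 - t * ((1 - q i) / t) := by
        funext i
        rw [mul_div_cancel₀ _ ht, sub_sub_cancel]
      rw [hq] at e'
      exact SocleDeformation.arisesFromFormalDeformation hm _ e'
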